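/- Let $\Bbbk$ be a field; algebras are associative unital $\Bbbk$-algebras and $\otimes=\otimes_{\Bbbk}$. A *deformation sequence* $Z \overset{\iota}{\hookrightarrow} Q \overset{\pi}{\twoheadrightarrow} R$ consists of algebra maps $\iota: Z\to Q$, $\pi: Q\to R$ and augmentations (algebra maps to $\Bbbk$) $\epsilon_Z,\epsilon_Q,\epsilon_R$ of $Z,Q,R$ with $\epsilon_Q\iota=\epsilon_Z$ and $\epsilon_R\pi=\epsilon_Q$, such that: $\iota$ is injective; $\pi$ is surjective; $\ker\pi = Q\,\iota(Z^+)$ with $Z^+=\ker\epsilon_Z$; $Q$ is finitely generated and flat as a left $Z$-module; $Z$ is a finitely generated commutative algebra, smooth over $\Bbbk$, with $\iota(Z)$ central in $Q$; and $Q$ has finite global dimension. A *deformation sequence of Hopf algebras* $W \overset{\jmath}{\hookrightarrow} H \overset{\wp}{\twoheadrightarrow} K$ consists of Hopf algebra maps $\jmath,\wp$ that form a deformation sequence with respect to the counits and satisfy $\jmath(W)=H^{\mathrm{co}\,\wp}=\{h\in H : h_{(1)}\otimes\wp(h_{(2)})=h\otimes 1\}$. An *$H$-module algebra* is an algebra $A$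 with a left $H$-module structure such that $h\cdot(ab)=(h_{(1)}\cdot a)(h_{(2)}\cdot b)$ and $h\cdot 1=\epsilon_H(h)1$; it is *augmented* by $\epsilon_A$ if $\epsilon_A(h\cdot a)=\epsilon_H(h)\epsilon_A(a)$. The smash product $A\rtimes H$ is $A\otimes H$ with multiplication $(a\otimes h)(b\otimes t)=a(h_{(1)}\cdot b)\otimes h_{(2)}t$. Let $\mathfrak C: W \overset{\jmath}{\hookrightarrow} H \overset{\wp}{\twoheadrightarrow} K$ be a deformation sequence of Hopf algebras and let $Z \overset{\iota}{\hookrightarrow} Q \overset{\pi}{\twoheadrightarrow} R$ be a *$\mathfrak C$-equivariant* deformation sequence; that is, a deformation sequence in which $Z,Q,R$ are augmented $H$-module algebras (with respect to $\epsilon_Z,\epsilon_Q,\epsilon_R$), $\iota$ and $\pi$ are $H$-linear, $W$ acts trivially on $Q$ (i.e. $\jmath(w)\cdot q=\epsilon_W(w)q$), and $H$ acts trivially on $Z$ (i.e. $h\cdot z=\epsilon_H(h)z$). Then: (i) $R$ has a $K$-module algebra structure such that $\pi(h\cdot q)=\wp(h)\cdot\pi(q)$ for all $h\in H$, $q\in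 Q$. (ii) With this structure, the maps $z\otimes w\mapsto\iota(z)\otimes\jmath(w)$ and $q\otimes h\mapsto\pi(q)\otimes\wp(h)$ are algebra maps, and they form a deformation sequence $$Z\otimes W \overset{\iota\rtimes\jmath}{\hookrightarrow} Q\rtimes H \overset{\pi\rtimes\wp}{\twoheadrightarrow} R\rtimes K$$ with respect to the augmentations $\epsilon_Z\otimes\epsilon_W$, $\epsilon_Q\otimes\epsilon_H$ and $\epsilon_R\otimes\epsilon_K$, where $Z\otimes W$ has the componentwise multiplication. -/

import Mathlib

open scoped TensorProduct
open CategoryTheory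

universe u v w x

noncomputable section

/-! ### Module algebras and smash products -/

/-- A (left) `H`-module algebra structure on the `k`-algebra `A`: a representation of the algebra `H`
on `A` with `h · (ab) = (h₁ · a)(h₂ · b)` and `h · 1 = ε(h) 1`. -/
structure ModuleAlgebra (k : Type u) (H : Type v) (A : Type w) [Field k] [Ring H]
    [HopfAlgebra k H] [Ring A] [Algebra k A] where
  /-- The representation of `H` on `A`. -/
  action : H →ₐ[k] Module.End k A
  action_mul : ∀ (h : H) (a b : A),
    action h (a * b) = LinearMap.mul' k A
      (TensorProduct.map (action.toLinearMap.flip a) (action.toLinearMap.flip b)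
        (Coalgebra.comul (R := k) h))
  action_one : ∀ h : H, action h 1 = algebraMap k A (Coalgebra.counit (R := k) h)

namespace ModuleAlgebra

variable {k : Type u} {H : Type v} {A : Type w} {B : Type x} [Field k] [Ring H] [HopfAlgebra k H]
  [Ring A] [Algebra k A] [Ring B] [Algebra k B]

/-- `(A, ε)` is an augmented `H`-module algebra: `ε(h · a) = ε_H(h) ε(a)`. -/
def IsAugmented (M : ModuleAlgebra k H A) (ε : A →ₐ[k] k) : Prop :=
  ∀ (h : H) (a : A), ε (M.action h a) = Coalgebra.counit (R := k) h * ε a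

/-- The algebra map `f : A → B` is a morphism of `H`-modules. -/
def IsEquivariantMap (M : ModuleAlgebra k H A) (N : ModuleAlgebra k H B) (f : A →ₐ[k] B) : Prop :=
  ∀ (h : H) (a : A), f (M.action h a) = N.action h (f a)

/-- The element `h` acts trivially on `A`, that is, by the scalar `ε(h)`. -/
def ActsTrivially (M : ModuleAlgebra k H A) (h : H) : Prop :=
  ∀ a : A, M.action h a = Coalgebra.counit (R := k) h • a

/-- Left multiplication by `a ∈ A` on `A ⊗ H`. -/
def leftMul : A →ₗ[k] Module.End k (A ⊗[k] H) :=
  LinearMap.rTensorHom H ∘ₗ LinearMap.mul k A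

/-- The diagonal action of `H` on `A ⊗ H`, `h · (a ⊗ t) = h₁ · a ⊗ h₂ t`. -/
def diag (M : ModuleAlgebra k H A) : H →ₐ[k] Module.End k (A ⊗[k] H) :=
  ((Module.endTensorEndAlgHom (R := k) (S := k) (A := k) (M := A) (N := H)).comp
    (Algebra.TensorProduct.map M.action (Algebra.lmul k H))).comp (Bialgebra.comulAlgHom k H)

/-- The multiplication of the smash product on `A ⊗ H`: `a ⊗ h` acts as left multiplication by `a`
after the diagonal action of `h`, so that `(a ⊗ h)(b ⊗ t) = a (h₁ · b) ⊗ h₂ t`. -/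
def smashMul (M : ModuleAlgebra k H A) :
    A ⊗[k] H →ₗ[k] A ⊗[k] H →ₗ[k] A ⊗[k] H :=
  TensorProduct.lift ((LinearMap.mul k (Module.End k (A ⊗[k] H))).compl₁₂ leftMul
    M.diag.toLinearMap)

theorem leftMul_tmul (a b : A) (t : H) :
    leftMul (k := k) a (b ⊗ₜ[k] t) = (a * b) ⊗ₜ t := rfl

theorem leftMul_mul (a b : A) :
    leftMul (k := k) (H := H) (a * b) = leftMul a * leftMul b := by
  ext x t
  simp [leftMul_tmul, mul_assoc]

theorem leftMul_one : leftMul (k := k) (H := H) (1 : A) = 1 := by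
  ext x t
  simp [leftMul_tmul]

theorem diag_tmul (M : ModuleAlgebra k H A) (h : H) (b : A) (t : H) :
    M.diag h (b ⊗ₜ t) = TensorProduct.map (M.action.toLinearMap.flip b)
      ((LinearMap.mul k H).flip t) (Coalgebra.comul (R := k) h) := by
  have : ∀ u : H ⊗[k] H, (Module.endTensorEndAlgHom (R := k) (S := k) (A := k) (M := A) (N := H))
      (Algebra.TensorProduct.map M.action (Algebra.lmul k H) u) (b ⊗ₜ t) =
      TensorProduct.map (M.action.toLinearMap.flip b) ((LinearMap.mul k H).flip t) u := by
    intro u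
    induction u with
    | zero => simp
    | add x y hx hy => simp only [map_add, LinearMap.add_apply, hx, hy]
    | tmul x y => simp [Module.endTensorEndAlgHom_apply]
  exact this _

theorem smashMul_tmul (M : ModuleAlgebra k H A) (a : A) (h : H) :
    M.smashMul (a ⊗ₜ h) = leftMul a * M.diag h := rfl

/-- The product of pure tensors in the smash product, `a (h₁ · b) ⊗ h₂ t`. -/
theorem smashMul_tmul_tmul (M : ModuleAlgebra k H A) (a b : A) (h t : H) :
    M.smashMul (a ⊗ₜ h) (b ⊗ₜ t) =
      TensorProduct.map (LinearMap.mulLeft k a ∘ₗ M.action.toLinearMap.flip b)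
        (LinearMap.mulRight k t) (Coalgebra.comul (R := k) h) := by
  rw [smashMul_tmul, Module.End.mul_apply, diag_tmul]
  induction Coalgebra.comul (R := k) h with
  | zero => simp
  | add x y hx hy => simp only [map_add, hx, hy]
  | tmul x y => simp [leftMul_tmul]

theorem diag_mul_leftMul (M : ModuleAlgebra k H A) (h : H) (y : A) :
    M.diag h * leftMul y = M.smashMul (M.diag h (y ⊗ₜ 1)) := by
  refine TensorProduct.ext' fun a s => ?_
  let Φ : H ⊗[k] (H ⊗[k] H) →ₗ[k] A ⊗[k] H :=
    TensorProduct.map (LinearMap.mul' k A ∘ₗ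
      TensorProduct.map (M.action.toLinearMap.flip y) (M.action.toLinearMap.flip a))
      ((LinearMap.mul k H).flip s) ∘ₗ (TensorProduct.assoc k H H H).symm.toLinearMap
  have h1 : (M.diag h * leftMul y : Module.End k (A ⊗[k] H)) (a ⊗ₜ s) = Φ ((TensorProduct.assoc k H H H)
      ((Coalgebra.comul (R := k) (A := H)).rTensor H (Coalgebra.comul (R := k) h))) := by
    rw [Module.End.mul_apply, leftMul_tmul, diag_tmul]
    simp only [Φ, LinearMap.comp_apply, LinearEquiv.coe_coe, LinearEquiv.symm_apply_apply]
    induction Coalgebra.comul (R := k) h with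
    | zero => simp
    | add x y hx hy => simp only [map_add, hx, hy]
    | tmul p q => simp [M.action_mul]
  have h2 : M.smashMul (M.diag h (y ⊗ₜ 1)) (a ⊗ₜ s) =
      Φ ((Coalgebra.comul (R := k) (A := H)).lTensor H (Coalgebra.comul (R := k) h)) := by
    rw [diag_tmul]
    induction Coalgebra.comul (R := k) h with
    | zero => simp
    | add x y hx hy => simp only [map_add, LinearMap.add_apply, hx, hy]
    | tmul p q =>
      simp only [TensorProduct.map_tmul, LinearMap.flip_apply, LinearMap.mul_apply', mul_one,
        LinearMap.lTensor_tmul, smashMul_tmul, Module.End.mul_apply, diag_tmul]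
      induction Coalgebra.comul (R := k) q with
      | zero => simp
      | add x y hx hy => simp only [map_add, TensorProduct.tmul_add, hx, hy]
      | tmul r t => simp [Φ, leftMul_tmul]
  rw [h1, h2, Coalgebra.coassoc_apply]

theorem smashMul_leftMul (M : ModuleAlgebra k H A) (a : A) (v : A ⊗[k] H) :
    M.smashMul (leftMul a v) = leftMul a * M.smashMul v := by
  induction v with
  | zero => simp
  | add x y hx hy => simp only [map_add, hx, hy, mul_add]
  | tmul b t => rw [leftMul_tmul, smashMul_tmul, smashMul_tmul, leftMul_mul, mul_assoc]

theorem smashMul_diag (M : ModuleAlgebra k H A) (h : H) (v : A ⊗[k] H) :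
    M.smashMul (M.diag h v) = M.diag h * M.smashMul v := by
  have key : ∀ (u : A ⊗[k] H) (t : H), M.smashMul ((LinearMap.mulRight k t).lTensor A u) =
      M.smashMul u * M.diag t := by
    intro u t
    induction u with
    | zero => simp
    | add x y hx hy => simp only [map_add, hx, hy, add_mul]
    | tmul b s => simp [smashMul_tmul, mul_assoc]
  induction v with
  | zero => simp
  | add x y hx hy => simp only [map_add, hx, hy, mul_add]
  | tmul b t =>
    have h1 : M.diag h (b ⊗ₜ t) =
        (LinearMap.mulRight k t).lTensor A (M.diag h (b ⊗ₜ 1)) := by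
      rw [diag_tmul, diag_tmul]
      induction Coalgebra.comul (R := k) h with
      | zero => simp
      | add x y hx hy => simp only [map_add, hx, hy]
      | tmul p q => simp
    rw [h1, key, ← diag_mul_leftMul, smashMul_tmul, mul_assoc]

theorem smashMul_assoc (M : ModuleAlgebra k H A) (x y : A ⊗[k] H) :
    M.smashMul (M.smashMul x y) = M.smashMul x * M.smashMul y := by
  induction x with
  | zero => simp
  | add x z hx hz => simp only [map_add, LinearMap.add_apply, hx, hz, add_mul]
  | tmul a h =>
    rw [smashMul_tmul, Module.End.mul_apply, smashMul_leftMul, smashMul_diag, mul_assoc]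

theorem one_smashMul (M : ModuleAlgebra k H A) : M.smashMul (1 ⊗ₜ 1) = 1 := by
  rw [smashMul_tmul, leftMul_one, map_one, mul_one]

theorem smashMul_one (M : ModuleAlgebra k H A) (x : A ⊗[k] H) :
    M.smashMul x (1 ⊗ₜ 1) = x := by
  induction x with
  | zero => simp
  | add x z hx hz => simp only [map_add, LinearMap.add_apply, hx, hz]
  | tmul a h =>
    rw [smashMul_tmul_tmul]
    have : ∀ u : H ⊗[k] H, TensorProduct.map (LinearMap.mulLeft k a ∘ₗ
        M.action.toLinearMap.flip 1) (LinearMap.mulRight k (1 : H)) u =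
        TensorProduct.map (LinearMap.toSpanSingleton k A a) LinearMap.id
          ((Coalgebra.counit (R := k) (A := H)).rTensor H u) := by
      intro u
      induction u with
      | zero => simp
      | add x y hx hy => simp only [map_add, hx, hy]
      | tmul p q =>
        simp [M.action_one, Algebra.algebraMap_eq_smul_one]
    rw [this, Coalgebra.rTensor_counit_comul]
    simp

/-- The smash product `A ⋊ H` of an `H`-module algebra `A` with `H`: the vector space `A ⊗ H` with
the multiplication `(a ⊗ h)(b ⊗ t) = a (h₁ · b) ⊗ h₂ t`. -/
def Smash (_M : ModuleAlgebra k H A) : Type (max v w) := A ⊗[k] H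

namespace Smash

variable (M : ModuleAlgebra k H A)

instance : AddCommGroup M.Smash := inferInstanceAs (AddCommGroup (A ⊗[k] H))

instance : Module k M.Smash := inferInstanceAs (Module k (A ⊗[k] H))

/-- The element `a ⊗ h` of `A ⋊ H`. -/
def tmul (a : A) (h : H) : M.Smash := a ⊗ₜ[k] h

instance : Ring M.Smash where
  __ := (inferInstance : AddCommGroup M.Smash)
  mul x y := M.smashMul x y
  one := tmul M 1 1
  left_distrib x y z := map_add (M.smashMul x) y z
  right_distrib x y z := LinearMap.congr_fun (map_add M.smashMul x y) z
  zero_mul x := LinearMap.congr_fun (map_zero M.smashMul) x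
  mul_zero x := map_zero (M.smashMul x)
  mul_assoc x y z := LinearMap.congr_fun (M.smashMul_assoc x y) z
  one_mul x := LinearMap.congr_fun M.one_smashMul x
  mul_one x := M.smashMul_one x

instance : Algebra k M.Smash := Algebra.ofModule
  (fun r x y => LinearMap.congr_fun (map_smul M.smashMul r x) y)
  (fun r x y => map_smul (M.smashMul x) r y)

end Smash

end ModuleAlgebra

/-! ### Deformation sequences -/

/-- The ring `A` has finite (left) global dimension. -/
def HasFiniteGlobalDimension (A : Type u) [Ring A] : Prop :=
  ∃ n : ℕ, ∀ M : ModuleCat.{u} A, HasProjectiveDimensionLE M n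

/-- The algebra maps `ι : Z → Q` and `π : Q → R` form a deformation sequence, with respect to the
distinguished point `εZ` of `Z` and the augmentations `εQ` and `εR` of `Q` and `R`. -/
structure IsDeformationSequence {k : Type u} {Z Q R : Type u} [Field k] [CommRing Z] [Algebra k Z]
    [Ring Q] [Algebra k Q] [Ring R] [Algebra k R] (ι : Z →ₐ[k] Q) (π : Q →ₐ[k] R)
    (εZ : Z →ₐ[k] k) (εQ : Q →ₐ[k] k) (εR : R →ₐ[k] k) : Prop where
  injective : Function.Injective ι
  surjective : Function.Surjective π
  /-- The kernel of `π` is the left ideal `Q Z⁺` generated by `Z⁺ = ker εZ`. -/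
  ker_eq : RingHom.ker π = Ideal.span (ι '' (RingHom.ker εZ : Set Z))
  finite : letI : Module Z Q := Module.compHom Q ι.toRingHom; Module.Finite Z Q
  flat : letI : Module Z Q := Module.compHom Q ι.toRingHom; Module.Flat Z Q
  smooth : Algebra.Smooth k Z
  finiteType : Algebra.FiniteType k Z
  central : ∀ (z : Z) (q : Q), ι z * q = q * ι z
  augmentation_ι : εQ.comp ι = εZ
  augmentation_π : εR.comp π = εQ
  finiteGlobalDimension : HasFiniteGlobalDimension Q

/-- The Hopf algebra maps `j : W → H` and `p : H → K` form an exact sequence of Hopf algebras. -/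
structure IsHopfExact {k : Type u} {W H K : Type u} [Field k] [Ring W] [HopfAlgebra k W]
    [Ring H] [HopfAlgebra k H] [Ring K] [HopfAlgebra k K]
    (j : W →ₐc[k] H) (p : H →ₐc[k] K) : Prop where
  injective : Function.Injective j
  surjective : Function.Surjective p
  /-- `ker p = H W⁺`. -/
  ker_eq : RingHom.ker p =
    Ideal.span (j '' (RingHom.ker (Bialgebra.counitAlgHom k W) : Set W))
  /-- `W` is the algebra of right coinvariants of `p`, `{h | h₁ ⊗ p(h₂) = h ⊗ 1}`. -/
  range_eq : Set.range j =
    {h : H | TensorProduct.map LinearMap.id (p : H →ₗ[k] K) (Coalgebra.comul (R := k) h) =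
      h ⊗ₜ[k] (1 : K)}

/-- A deformation sequence of Hopf algebras: an exact sequence of Hopf algebras that is also a
deformation sequence with respect to the counits. -/
structure IsHopfDeformationSequence {k : Type u} {W H K : Type u} [Field k]
    [CommRing W] [HopfAlgebra k W] [Ring H] [HopfAlgebra k H] [Ring K] [HopfAlgebra k K]
    (j : W →ₐc[k] H) (p : H →ₐc[k] K) : Prop where
  exact : IsHopfExact j p
  deformation : IsDeformationSequence (j : W →ₐ[k] H) (p : H →ₐ[k] K)
    (Bialgebra.counitAlgHom k W) (Bialgebra.counitAlgHom k H) (Bialgebra.counitAlgHom k K)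

/-- The deformation sequence `Z → Q → R`, with `Z`, `Q`, `R` endowed with the `H`-module algebra
structures `actZ`, `actQ`, `actR`, is equivariant with respect to the deformation sequence of Hopf
algebras `W → H → K` with first map `j`. -/
structure IsEquivariantDeformationSequence {k : Type u} {W H Z Q R : Type u} [Field k]
    [CommRing W] [HopfAlgebra k W] [Ring H] [HopfAlgebra k H]
    [CommRing Z] [Algebra k Z] [Ring Q] [Algebra k Q] [Ring R] [Algebra k R]
    (j : W →ₐc[k] H) (ι : Z →ₐ[k] Q) (π : Q →ₐ[k] R)
    (εZ : Z →ₐ[k] k) (εQ : Q →ₐ[k] k) (εR : R →ₐ[k] k)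
    (actZ : ModuleAlgebra k H Z) (actQ : ModuleAlgebra k H Q) (actR : ModuleAlgebra k H R) :
    Prop where
  deformation : IsDeformationSequence ι π εZ εQ εR
  augmented_Z : actZ.IsAugmented εZ
  augmented_Q : actQ.IsAugmented εQ
  augmented_R : actR.IsAugmented εR
  equivariant_ι : actZ.IsEquivariantMap actQ ι
  equivariant_π : actQ.IsEquivariantMap actR π
  trivial_W : ∀ w : W, actQ.ActsTrivially (j w)
  trivial_Z : ∀ h : H, actZ.ActsTrivially h

end

universe uk uH uV

noncomputable section

/-! The kernel of `p` is `H W⁺`, and it kills `R` because `W` acts trivially on `Q`; so the action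
of `H` on `R` descends to `K`. Inside `Q ⋊ H` the trivial actions make `Z` commute with `H` and `W`
with `Q`, so `Z ⊗ W` embeds centrally. The kernel of `π ⊗ p` is `ker π ⊗ H + Q ⊗ ker p`, generated
by `Z⁺` and `W⁺`. Finite flat modules over the Noetherian rings `Z` and `W` are projective, so `Q ⊗
H` is a retract of a finite free `Z ⊗ W`-module.

The substantial point is the finite global dimension of `Q ⋊ H` (`hasFiniteGlobalDimension_smash`).
It suffices to bound by `n = gldim H` the projective dimension of a `Q ⋊ H`-module `X` that is
projective over `Q`; dimension shifting then gives the bound `n + gldim Q`. For a right `H`-module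
`V` and a `Q ⋊ H`-module `N`, the space `Hom(V, N)` is a `Q ⋊ H`-module through `(h · f)(v) = h₁ f(v
h₂)`. It is exact in `V`, and `Hom(k, N) = N` for the trivial module `k`. The module `Hom(H, N)` is
cofree: maps into it are `Q`-linear maps to `N`. Hence for `V` finitely generated projective the
higher `Ext` groups from `X` to `Hom(V, N)` vanish, and a resolution of `k` of length `n` by such
modules gives the bound.

Finite global dimension concerns left modules, while the resolution is one of right modules. Duals
over the ground field connect the two sides: free right modules of finite rank have injective duals,
the dual of `k` has injective dimension at most `n`, so the dual of the `n`-th syzygy is injective,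
and a finitely presented right module with injective dual is projective
(`Module.Projective.of_rightDual_injective`). The syzygies are finitely generated because `H` is
finite over the central Noetherian subalgebra `W`. -/

theorem comul_bialgHom {k W H : Type*} [CommSemiring k] [Semiring W] [Semiring H] [Bialgebra k W]
    [Bialgebra k H] (f : W →ₐc[k] H) (w : W) :
    Coalgebra.comul (R := k) (f w) =
      TensorProduct.map (f : W →ₗ[k] H) (f : W →ₗ[k] H) (Coalgebra.comul (R := k) w) :=
  (CoalgHomClass.map_comp_comul_apply f w).symm

theorem counit_bialgHom {k W H : Type*} [CommSemiring k] [Semiring W] [Semiring H] [Bialgebra k W]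
    [Bialgebra k H] (f : W →ₐc[k] H) (w : W) :
    Coalgebra.counit (R := k) (f w) = Coalgebra.counit (R := k) w :=
  CoalgHomClass.counit_comp_apply f w

/-! ### Smash products: universal property, functoriality, descent of actions. -/

namespace ModuleAlgebra

variable {k : Type u} {H : Type v} {A : Type w} [Field k] [Ring H] [HopfAlgebra k H]
  [Ring A] [Algebra k A]

namespace Smash

variable (M : ModuleAlgebra k H A)

/-- The smash product, as a vector space, is the tensor product. -/
def equivTensor : M.Smash ≃ₗ[k] A ⊗[k] H := LinearEquiv.refl k (A ⊗[k] H)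

@[simp] theorem equivTensor_tmul (a : A) (h : H) : equivTensor M (tmul M a h) = a ⊗ₜ h := rfl

@[simp] theorem equivTensor_symm_tmul (a : A) (h : H) :
    (equivTensor M).symm (a ⊗ₜ h) = tmul M a h := rfl

theorem one_def : (1 : M.Smash) = tmul M 1 1 := rfl

theorem mul_def (x y : M.Smash) :
    x * y = (equivTensor M).symm (M.smashMul (equivTensor M x) (equivTensor M y)) := rfl

variable {M} in
@[elab_as_elim]
theorem induction_on {P : M.Smash → Prop} (x : M.Smash) (zero : P 0)
    (tmul : ∀ a h, P (tmul M a h)) (add : ∀ x y, P x → P y → P (x + y)) : P x :=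
  TensorProduct.induction_on (motive := P) x zero tmul add

theorem tmul_mul_tmul (a b : A) (h t : H) :
    tmul M a h * tmul M b t = (equivTensor M).symm
      (TensorProduct.map (LinearMap.mulLeft k a ∘ₗ M.action.toLinearMap.flip b)
        (LinearMap.mulRight k t) (Coalgebra.comul (R := k) h)) := by
  rw [mul_def, equivTensor_tmul, equivTensor_tmul, smashMul_tmul_tmul]

/-- The inclusion of the module algebra in the smash product. -/
def inl : A →ₐ[k] M.Smash :=
  AlgHom.ofLinearMap ((equivTensor M).symm.toLinearMap ∘ₗ (TensorProduct.mk k A H).flip 1) rfl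
    fun a b => by
      change tmul M (a * b) 1 = tmul M a 1 * tmul M b 1
      rw [tmul_mul_tmul, Bialgebra.comul_one, Algebra.TensorProduct.one_def]
      simp

/-- The inclusion of the Hopf algebra in the smash product. -/
def inr : H →ₐ[k] M.Smash :=
  AlgHom.ofLinearMap ((equivTensor M).symm.toLinearMap ∘ₗ TensorProduct.mk k A H 1) rfl
    fun h t => by
      change tmul M 1 (h * t) = tmul M 1 h * tmul M 1 t
      rw [tmul_mul_tmul]
      have : ∀ u : H ⊗[k] H, TensorProduct.map (LinearMap.mulLeft k (1 : A) ∘ₗ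
          M.action.toLinearMap.flip 1) (LinearMap.mulRight k t) u =
          TensorProduct.map (Algebra.linearMap k A) (LinearMap.mulRight k t)
            ((Coalgebra.counit (R := k) (A := H)).rTensor H u) := by
        intro u
        induction u with
        | zero => simp
        | add x y hx hy => simp only [map_add, hx, hy]
        | tmul p q => simp [M.action_one]
      rw [this, Coalgebra.rTensor_counit_comul]
      simp

theorem inl_apply (a : A) : inl M a = tmul M a 1 := rfl

theorem inr_apply (h : H) : inr M h = tmul M 1 h := rfl

theorem inl_mul_inr (a : A) (h : H) : inl M a * inr M h = tmul M a h := by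
  rw [inl_apply, inr_apply, tmul_mul_tmul, Bialgebra.comul_one, Algebra.TensorProduct.one_def]
  simp

/-- The commutation rule `h a = (h₁ · a) h₂` in the smash product. -/
theorem inr_mul_inl (h : H) (a : A) :
    inr M h * inl M a = LinearMap.mul' k M.Smash
      (TensorProduct.map ((inl M).toLinearMap ∘ₗ M.action.toLinearMap.flip a)
        (inr M).toLinearMap (Coalgebra.comul (R := k) h)) := by
  rw [inl_apply, inr_apply, tmul_mul_tmul]
  induction Coalgebra.comul (R := k) h with
  | zero => simp
  | add x y hx hy => simp only [map_add, hx, hy]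
  | tmul p q => simp [inl_mul_inr]

theorem inl_mul_tmul (a b : A) (h : H) : inl M a * tmul M b h = tmul M (a * b) h := by
  rw [← inl_mul_inr, ← mul_assoc, ← map_mul, inl_mul_inr]

variable {E : Type*} [Ring E] [Algebra k E]

/-- The universal property of the smash product. -/
def lift (α : A →ₐ[k] E) (β : H →ₐ[k] E)
    (comm : ∀ h a, β h * α a = LinearMap.mul' k E
      (TensorProduct.map (α.toLinearMap ∘ₗ M.action.toLinearMap.flip a) β.toLinearMap
        (Coalgebra.comul (R := k) h))) : M.Smash →ₐ[k] E :=
  AlgHom.ofLinearMap (TensorProduct.lift ((LinearMap.mul k E).compl₁₂ α.toLinearMap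
      β.toLinearMap) ∘ₗ (equivTensor M).toLinearMap)
    (by rw [one_def]; simp)
    (by
      intro x y
      induction x using Smash.induction_on with
      | zero => simp
      | add x z hx hz => simp only [add_mul, map_add, hx, hz]
      | tmul a h =>
        induction y using Smash.induction_on with
        | zero => simp
        | add x z hx hz => simp only [mul_add, map_add, hx, hz]
        | tmul b t =>
          rw [tmul_mul_tmul]
          simp only [LinearMap.comp_apply, LinearEquiv.coe_coe, LinearEquiv.apply_symm_apply,
            equivTensor_tmul, TensorProduct.lift.tmul, LinearMap.compl₁₂_apply,
            LinearMap.mul_apply', AlgHom.toLinearMap_apply]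
          rw [mul_assoc, ← mul_assoc (β h), comm]
          induction Coalgebra.comul (R := k) h with
          | zero => simp
          | add x y hx hy => simp only [map_add, hx, hy, add_mul, mul_add]
          | tmul p q => simp [mul_assoc])

section lift

variable (α : A →ₐ[k] E) (β : H →ₐ[k] E)
    (comm : ∀ h a, β h * α a = LinearMap.mul' k E
      (TensorProduct.map (α.toLinearMap ∘ₗ M.action.toLinearMap.flip a) β.toLinearMap
        (Coalgebra.comul (R := k) h)))

@[simp] theorem lift_tmul (a : A) (h : H) : lift M α β comm (tmul M a h) = α a * β h := rfl

@[simp] theorem lift_inl (a : A) : lift M α β comm (inl M a) = α a := by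
  rw [inl_apply, lift_tmul, map_one, mul_one]

@[simp] theorem lift_inr (h : H) : lift M α β comm (inr M h) = β h := by
  rw [inr_apply, lift_tmul, map_one, one_mul]

end lift

/-- The augmentation `ε ⊗ ε_H` of the smash product with an augmented module algebra. -/
def augmentation (ε : A →ₐ[k] k) (hε : M.IsAugmented ε) : M.Smash →ₐ[k] k :=
  lift M ε (Bialgebra.counitAlgHom k H) (by
    intro h a
    have : ∀ u : H ⊗[k] H, LinearMap.mul' k k
        (TensorProduct.map (ε.toLinearMap ∘ₗ M.action.toLinearMap.flip a)
          (Bialgebra.counitAlgHom k H).toLinearMap u) =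
        Coalgebra.counit (R := k) (TensorProduct.lid k H
          ((Coalgebra.counit (R := k) (A := H)).rTensor H u)) * ε a := by
      intro u
      induction u with
      | zero => simp
      | add x y hx hy => simp only [map_add, hx, hy, add_mul]
      | tmul p q => simp [hε p a]; ring
    rw [this, Coalgebra.rTensor_counit_comul]
    simp)

theorem augmentation_tmul (ε : A →ₐ[k] k) (hε : M.IsAugmented ε) (a : A) (h : H) :
    augmentation M ε hε (tmul M a h) = ε a * Coalgebra.counit (R := k) h := rfl

/-- The map of smash products `f ⋊ p` induced by a map of module algebras `f` that is compatible
with a map of Hopf algebras `p`. -/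
def map {K : Type*} {B : Type*} [Ring K] [HopfAlgebra k K] [Ring B] [Algebra k B]
    {M : ModuleAlgebra k H A} {N : ModuleAlgebra k K B} (f : A →ₐ[k] B) (p : H →ₐc[k] K)
    (hf : ∀ h a, f (M.action h a) = N.action (p h) (f a)) : M.Smash →ₐ[k] N.Smash :=
  lift M ((inl N).comp f) ((inr N).comp (p : H →ₐ[k] K)) (by
    intro h a
    change inr N (p h) * inl N (f a) = _
    rw [inr_mul_inl, comul_bialgHom]
    induction Coalgebra.comul (R := k) h with
    | zero => simp
    | add x y hx hy => simp only [map_add, hx, hy]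
    | tmul s t => simp [hf])

theorem map_tmul {K : Type*} {B : Type*} [Ring K] [HopfAlgebra k K] [Ring B] [Algebra k B]
    {M : ModuleAlgebra k H A} {N : ModuleAlgebra k K B} (f : A →ₐ[k] B) (p : H →ₐc[k] K)
    (hf : ∀ h a, f (M.action h a) = N.action (p h) (f a)) (a : A) (h : H) :
    map f p hf (tmul M a h) = tmul N (f a) (p h) := by
  rw [map, lift_tmul, ← inl_mul_inr]; rfl

variable {M}

/-- An element of `A` on which `H` acts trivially commutes with `H` in the smash product. -/
theorem commute_inl_inr {a : A}
    (ha : ∀ h, M.action h a = Coalgebra.counit (R := k) h • a) (h : H) :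
    Commute (inl M a) (inr M h) := by
  rw [Commute, SemiconjBy, inr_mul_inl]
  have : ∀ u : H ⊗[k] H, LinearMap.mul' k M.Smash
      (TensorProduct.map ((inl M).toLinearMap ∘ₗ M.action.toLinearMap.flip a)
        (inr M).toLinearMap u) =
      inl M a * inr M (TensorProduct.lid k H
        ((Coalgebra.counit (R := k) (A := H)).rTensor H u)) := by
    intro u
    induction u with
    | zero => simp
    | add x y hx hy => simp only [map_add, hx, hy, mul_add]
    | tmul p q => simp [ha]
  rw [this, Coalgebra.rTensor_counit_comul]
  simp

/-- If `W` acts trivially on `A`, then `A` commutes with `W` in the smash product. -/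
theorem commute_inr_inl {W : Type*} [Ring W] [HopfAlgebra k W] (j : W →ₐc[k] H)
    (hj : ∀ w, M.ActsTrivially (j w)) (w : W) (a : A) :
    Commute (inr M (j w)) (inl M a) := by
  rw [Commute, SemiconjBy, inr_mul_inl, comul_bialgHom]
  have : ∀ u : W ⊗[k] W, LinearMap.mul' k M.Smash
      (TensorProduct.map ((inl M).toLinearMap ∘ₗ M.action.toLinearMap.flip a)
        (inr M).toLinearMap (TensorProduct.map (j : W →ₗ[k] H) (j : W →ₗ[k] H) u)) =
      inl M a * inr M (j (TensorProduct.lid k W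
        ((Coalgebra.counit (R := k) (A := W)).rTensor W u))) := by
    intro u
    induction u with
    | zero => simp
    | add x y hx hy => simp only [map_add, hx, hy, mul_add]
    | tmul p q => simp [hj p a]
  rw [this, Coalgebra.rTensor_counit_comul]
  simp

end Smash

/-- An algebra map descends along a surjection whose kernel it annihilates. -/
def _root_.AlgHom.descend {K E : Type*} [Ring K] [Algebra k K] [Ring E] [Algebra k E]
    (p : H →ₐ[k] K) (hp : Function.Surjective p) (g : H →ₐ[k] E) (hker : ∀ h, p h = 0 → g h = 0) :
    K →ₐ[k] E :=
  -- The value does not depend on the chosen preimage; this makes all the axioms formal.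
  have happ (h : H) : g (Function.surjInv hp (p h)) = g h := by
    rw [← sub_eq_zero, ← map_sub]
    exact hker _ (by rw [map_sub, Function.surjInv_eq hp, sub_self])
  { toFun t := g (Function.surjInv hp t)
    map_one' := by rw [← map_one p, happ, map_one]
    map_mul' := hp.forall₂.2 fun a b => by rw [← map_mul, happ, happ, happ, map_mul]
    map_zero' := by rw [← map_zero p, happ, map_zero]
    map_add' := hp.forall₂.2 fun a b => by rw [← map_add, happ, happ, happ, map_add]
    commutes' r := by rw [← AlgHom.commutes p, happ, AlgHom.commutes] }

theorem _root_.AlgHom.descend_apply {K E : Type*} [Ring K] [Algebra k K] [Ring E] [Algebra k E]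
    (p : H →ₐ[k] K) (hp : Function.Surjective p) (g : H →ₐ[k] E) (hker : ∀ h, p h = 0 → g h = 0)
    (h : H) : AlgHom.descend p hp g hker (p h) = g h := by
  change g (Function.surjInv hp (p h)) = g h
  rw [← sub_eq_zero, ← map_sub]
  exact hker _ (by rw [map_sub, Function.surjInv_eq hp, sub_self])

/-- A module algebra structure descends along a surjection of Hopf algebras whose kernel acts by
zero. -/
def descend {K : Type x} [Ring K] [HopfAlgebra k K] (M : ModuleAlgebra k H A) (p : H →ₐc[k] K)
    (hp : Function.Surjective p) (hker : ∀ h, p h = 0 → M.action h = 0) :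
    ModuleAlgebra k K A where
  action := AlgHom.descend (p : H →ₐ[k] K) hp M.action hker
  action_mul := by
    have happ (h : H) : AlgHom.descend (p : H →ₐ[k] K) hp M.action hker (p h) =
        M.action h := AlgHom.descend_apply (p : H →ₐ[k] K) hp M.action hker h
    intro t a b
    obtain ⟨h, rfl⟩ := hp t
    rw [happ, M.action_mul, comul_bialgHom]
    induction Coalgebra.comul (R := k) h with
    | zero => simp
    | add x y hx hy => simp only [map_add, hx, hy]
    | tmul s t => simp [happ]
  action_one := by
    have happ (h : H) : AlgHom.descend (p : H →ₐ[k] K) hp M.action hker (p h) =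
        M.action h := AlgHom.descend_apply (p : H →ₐ[k] K) hp M.action hker h
    intro t
    obtain ⟨h, rfl⟩ := hp t
    rw [happ, M.action_one, counit_bialgHom]

theorem descend_action {K : Type x} [Ring K] [HopfAlgebra k K] (M : ModuleAlgebra k H A)
    (p : H →ₐc[k] K) (hp : Function.Surjective p) (hker : ∀ h, p h = 0 → M.action h = 0) (h : H) :
    (M.descend p hp hker).action (p h) = M.action h :=
  AlgHom.descend_apply (p : H →ₐ[k] K) hp M.action hker h

end ModuleAlgebra

/-! ### Duals of right modules -/

section RightModules

open MulOpposite

section precompRight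

variable (k : Type*) {H : Type*} (V N : Type*) [Field k] [Ring H] [Algebra k H]
  [AddCommGroup V] [Module k V] [Module Hᵐᵒᵖ V] [IsScalarTower k Hᵐᵒᵖ V]
  [AddCommGroup N] [Module k N]

/-- For a right `H`-module `V`, the left action of `H` on the linear maps `V → N`,
`(h · f)(v) = f(v h)`. -/
def precompRight : H →ₐ[k] Module.End k (V →ₗ[k] N) :=
  AlgHom.ofLinearMap
    (((LinearMap.llcomp k V V N).flip ∘ₗ (Algebra.lsmul k k V).toLinearMap) ∘ₗ
      (opLinearEquiv k : H ≃ₗ[k] Hᵐᵒᵖ).toLinearMap)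
    (by ext; simp) (by intro a b; ext; simp)

@[simp] theorem precompRight_apply (h : H) (f : V →ₗ[k] N) (v : V) :
    precompRight k V N h f v = f (op h • v) := rfl

end precompRight

/-- The dual of the right `H`-module `V`, a left `H`-module. -/
def RightDual (k : Type*) (H : Type*) (V : Type*) [Field k] [Ring H] [Algebra k H]
    [AddCommGroup V] [Module k V] [Module Hᵐᵒᵖ V] [IsScalarTower k Hᵐᵒᵖ V] : Type _ :=
  V →ₗ[k] k

namespace RightDual

variable (k : Type*) (H : Type*) (V : Type*) [Field k] [Ring H] [Algebra k H]
  [AddCommGroup V] [Module k V] [Module Hᵐᵒᵖ V] [IsScalarTower k Hᵐᵒᵖ V]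

instance : AddCommGroup (RightDual k H V) := inferInstanceAs (AddCommGroup (V →ₗ[k] k))

instance : FunLike (RightDual k H V) V k := inferInstanceAs (FunLike (V →ₗ[k] k) V k)

instance : LinearMapClass (RightDual k H V) k V k :=
  inferInstanceAs (LinearMapClass (V →ₗ[k] k) k V k)

instance : Module H (RightDual k H V) :=
  Module.compHom (V →ₗ[k] k) (precompRight k (H := H) V k).toRingHom

variable {k H V}

/-- A functional, as an element of the dual. -/
def of (f : V →ₗ[k] k) : RightDual k H V := f

@[simp] theorem of_apply (f : V →ₗ[k] k) (v : V) : of (H := H) f v = f v := rfl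

@[simp] theorem smul_apply (h : H) (f : RightDual k H V) (v : V) : (h • f) v = f (op h • v) := rfl

@[simp] theorem add_apply (f g : RightDual k H V) (v : V) : (f + g) v = f v + g v := rfl

@[ext] theorem ext {f g : RightDual k H V} (h : ∀ v, f v = g v) : f = g := DFunLike.ext _ _ h

variable {V' : Type*} [AddCommGroup V'] [Module k V'] [Module Hᵐᵒᵖ V'] [IsScalarTower k Hᵐᵒᵖ V']

/-- The transpose of a map of right modules. -/
def map (φ : V →ₗ[Hᵐᵒᵖ] V') : RightDual k H V' →ₗ[H] RightDual k H V where
  toFun f := of ((show V' →ₗ[k] k from f) ∘ₗ φ.restrictScalars k)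
  map_add' _ _ := rfl
  map_smul' h f := by
    ext v
    change f (op h • φ v) = f (φ (op h • v))
    rw [map_smul φ]

@[simp] theorem map_apply (φ : V →ₗ[Hᵐᵒᵖ] V') (f : RightDual k H V') (v : V) :
    map φ f v = f (φ v) := rfl

end RightDual


variable {k : Type uk} {H : Type uH} [Field k] [Ring H] [Algebra k H]

/-- The dual of a free right module of finite rank is injective. -/
theorem RightDual.injective_pi (r : ℕ) :
    Module.Injective.{uH, max uk uH} H (RightDual k H (Fin r → Hᵐᵒᵖ)) where
  out X Y _ _ _ _ f hf g := by
    let _ : Module k X := Module.compHom X (algebraMap k H)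
    let _ : Module k Y := Module.compHom Y (algebraMap k H)
    have : IsScalarTower k H X := ⟨fun a h x => by
      change (a • h) • x = algebraMap k H a • h • x
      rw [Algebra.smul_def, mul_smul]⟩
    have : IsScalarTower k H Y := ⟨fun a h x => by
      change (a • h) • x = algebraMap k H a • h • x
      rw [Algebra.smul_def, mul_smul]⟩
    -- An `H`-linear map to the dual of a free module amounts to `r` functionals, its values at the
    -- basis vectors. Functionals extend along a merely `k`-linear retraction `s`.
    obtain ⟨s, hs⟩ := LinearMap.exists_leftInverse_of_injective (f.restrictScalars k)
      (LinearMap.ker_eq_bot.2 hf)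
    have hs' (x : X) : s (f x) = x := LinearMap.congr_fun hs x
    have hg_add (x y : X) (v) : g (x + y) v = g x v + g y v := by rw [map_add]; rfl
    let c (i : Fin r) : X →ₗ[k] k :=
      { toFun x := g x (Pi.single i 1)
        map_add' x y := hg_add x y _
        map_smul' a x := by
          rw [← algebraMap_smul H a x, map_smul, RightDual.smul_apply, RingHom.id_apply,
            ← map_smul (g x), ← MulOpposite.algebraMap_apply, algebraMap_smul] }
    -- Linearity forces this formula: the value for `y` at `eᵢ h` is the value for `h • y` at `eᵢ`.
    let G (y : Y) : (Fin r → Hᵐᵒᵖ) →ₗ[k] k :=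
      ∑ i, c i ∘ₗ s ∘ₗ (LinearMap.toSpanSingleton H Y y).restrictScalars k ∘ₗ
        (opLinearEquiv k : H ≃ₗ[k] Hᵐᵒᵖ).symm.toLinearMap ∘ₗ LinearMap.proj i
    have hG (y : Y) (v) : G y v = ∑ i, g (s (unop (v i) • y)) (Pi.single i 1) := by
      simp [G, c]
    refine ⟨{ toFun y := of (G y), map_add' := ?_, map_smul' := ?_ }, ?_⟩
    · intro x y
      ext v
      simp only [of_apply, add_apply, hG, smul_add, map_add, Finset.sum_add_distrib]
    · intro h y
      ext v
      simp only [of_apply, RingHom.id_apply, smul_apply, hG, Pi.smul_apply, smul_eq_mul,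
        unop_mul, unop_op, mul_smul]
    · intro x
      ext v
      change G (f x) v = _
      simp only [hG, ← map_smul f, hs']
      simp only [map_smul, smul_apply, op_unop]
      conv_rhs => rw [← Finset.univ_sum_single v, map_sum]
      refine Finset.sum_congr rfl fun i _ => ?_
      congr 1
      rw [← Pi.single_smul, smul_eq_mul, mul_one]

/-! ### Finitely presented right modules with injective dual are projective. -/

section Villamayor

variable {V : Type uV} [AddCommGroup V] [Module k V] [Module Hᵐᵒᵖ V] [IsScalarTower k Hᵐᵒᵖ V]
  {r : ℕ} (π : (Fin r → Hᵐᵒᵖ) →ₗ[Hᵐᵒᵖ] V)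

/-- If the dual of a quotient `V` of a free right module is injective, then every element of the
kernel is fixed by an endomorphism with values in the kernel. -/
theorem exists_endomorphism_fixing (hπ : Function.Surjective π)
    (hV : Module.Baer H (RightDual k H V)) (u : Fin r → Hᵐᵒᵖ) (hu : π u = 0) :
    ∃ θ : (Fin r → Hᵐᵒᵖ) →ₗ[Hᵐᵒᵖ] (Fin r → Hᵐᵒᵖ), (∀ x, π (θ x) = 0) ∧ θ u = u := by
  let K := LinearMap.ker π
  -- The range of `c` is `∑ K uᵢ`. If `u = ∑ κᵢ uᵢ` with `κᵢ` in the kernel `K`, then `eᵢ ↦ κᵢ` is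
  -- the required endomorphism.
  let c : (Fin r → K) →ₗ[k] (Fin r → Hᵐᵒᵖ) :=
    ∑ i, Algebra.lsmul k k (Fin r → Hᵐᵒᵖ) (u i) ∘ₗ K.subtype.restrictScalars k ∘ₗ LinearMap.proj i
  have hc (κ) : c κ = ∑ i, u i • (κ i : Fin r → Hᵐᵒᵖ) := by simp [c]
  by_cases huc : u ∈ LinearMap.range c
  · obtain ⟨κ, hκ⟩ := huc
    refine ⟨K.subtype ∘ₗ Fintype.linearCombination Hᵐᵒᵖ κ, fun x =>
      (Fintype.linearCombination Hᵐᵒᵖ κ x).2, ?_⟩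
    rw [← hκ, hc]
    simp [Fintype.linearCombination_apply, ← hc, hκ]
  exfalso
  -- Otherwise a functional `l` separates `u` from `∑ K uᵢ = K I`, where `I` is the left ideal
  -- generated by the `uᵢ`.
  obtain ⟨l, hlu, hl⟩ := Submodule.exists_le_ker_of_notMem huc
  obtain ⟨s, hs⟩ := LinearMap.exists_rightInverse_of_surjective (π.restrictScalars k)
    (LinearMap.range_eq_top.2 hπ)
  have hs' (v : V) : π (s v) = v := LinearMap.congr_fun hs v
  let I : Ideal H := Ideal.span (Set.range fun i => unop (u i))
  have hI {a : H} (ha : a ∈ I) {x : Fin r → Hᵐᵒᵖ} (hx : π x = 0) : l (op a • x) = 0 := by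
    induction ha using Submodule.span_induction generalizing x with
    | mem a ha =>
      obtain ⟨i, rfl⟩ := ha
      refine hl ⟨Pi.single i ⟨x, hx⟩, ?_⟩
      rw [hc, Finset.sum_eq_single i] <;> simp +contextual
    | zero => simp
    | add a b _ _ ha hb => rw [MulOpposite.op_add, add_smul, map_add, ha hx, hb hx, add_zero]
    | smul h a _ ha =>
      rw [smul_eq_mul, op_mul, mul_smul]
      exact ha (by rw [map_smul, hx, smul_zero])
  have hI' {a : H} (ha : a ∈ I) {x y : Fin r → Hᵐᵒᵖ} (hx : π x = π y) :
      l (op a • x) = l (op a • y) := by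
    rw [← sub_eq_zero, ← map_sub, ← smul_sub]
    exact hI ha (by rw [map_sub, hx, sub_self])
  -- The section `s` is only `k`-linear; `g` is `H`-linear because the errors lie in `K I`, where
  -- `l` vanishes.
  let g : I →ₗ[H] RightDual k H V :=
    { toFun a := RightDual.of (l ∘ₗ Algebra.lsmul k k (Fin r → Hᵐᵒᵖ) (op (a : H)) ∘ₗ s)
      map_add' a b := by
        ext v
        simp
      map_smul' h a := by
        ext v
        simp only [RightDual.of_apply, LinearMap.comp_apply, Algebra.lsmul_coe, RingHom.id_apply,
          RightDual.smul_apply, Submodule.coe_smul, smul_eq_mul, op_mul, mul_smul]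
        exact hI' a.2 (by rw [map_smul, hs', hs']) }
  obtain ⟨g', hg'⟩ := hV I g
  refine hlu ?_
  -- The extension `g'` is determined by the functional `g' 1` on `V`. Summing over `i` gives `l u =
  -- g' 1 (π u) = 0`, a contradiction.
  have key (i : Fin r) : l (Pi.single i (u i)) = g' 1 (π (Pi.single i (u i))) := by
    have hi : unop (u i) ∈ I := Ideal.subset_span ⟨i, rfl⟩
    have h1 := congrArg (fun f : RightDual k H V => f (π (Pi.single i 1))) (hg' _ hi)
    have h2 : g' (unop (u i)) = unop (u i) • g' 1 := by rw [← map_smul, smul_eq_mul, mul_one]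
    rw [h2, RightDual.smul_apply, op_unop, ← map_smul π, ← Pi.single_smul, smul_eq_mul,
      mul_one] at h1
    rw [h1]
    change _ = l (op (unop (u i)) • s (π (Pi.single i 1)))
    rw [hI' hi (hs' _), op_unop, ← Pi.single_smul, smul_eq_mul, mul_one]
  rw [← Finset.univ_sum_single u, map_sum, Finset.sum_congr rfl fun i _ => key i, ← map_sum,
    ← map_sum, Finset.univ_sum_single, hu, map_zero]

/-- Fixing finitely many elements at once makes one endomorphism fix a whole finitely generated
kernel. -/
theorem exists_endomorphism_fixing_list (hπ : Function.Surjective π)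
    (hV : Module.Baer H (RightDual k H V)) (L : List (Fin r → Hᵐᵒᵖ)) (hL : ∀ u ∈ L, π u = 0) :
    ∃ θ : (Fin r → Hᵐᵒᵖ) →ₗ[Hᵐᵒᵖ] (Fin r → Hᵐᵒᵖ), (∀ x, π (θ x) = 0) ∧ ∀ u ∈ L, θ u = u := by
  induction hn : L.length generalizing L with
  | zero => exact ⟨0, by simp, by simp [List.length_eq_zero_iff.1 hn]⟩
  | succ n ih =>
    obtain _ | ⟨a, L⟩ := L
    · simp at hn
    obtain ⟨θ, hθ, hθa⟩ := exists_endomorphism_fixing π hπ hV a (hL a (by simp))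
    obtain ⟨η, hη, hηL⟩ := ih (L.map fun u => u - θ u)
      (by
        intro v hv
        obtain ⟨u, hu, rfl⟩ := List.mem_map.1 hv
        rw [map_sub, hL u (by simp [hu]), hθ, sub_zero])
      (by simpa using hn)
    -- Chosen so that `1 - (θ + η - ηθ) = (1 - η)(1 - θ)`: the factor `1 - θ` kills the head, and `1
    -- - η` kills `u - θ u` for `u` in the tail.
    refine ⟨θ + η - η ∘ₗ θ, fun x => by simp [hθ, hη], fun u hu => ?_⟩
    simp only [LinearMap.sub_apply, LinearMap.add_apply, LinearMap.comp_apply]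
    obtain rfl | hu := List.mem_cons.1 hu
    · rw [hθa, add_sub_cancel_right]
    · have := hηL _ (List.mem_map_of_mem (f := fun u => u - θ u) hu)
      rw [map_sub] at this
      rw [add_sub_assoc, this, add_sub_cancel]

/-- A finitely presented right module with injective dual is projective. -/
theorem Module.Projective.of_rightDual_injective (hπ : Function.Surjective π)
    (hK : (LinearMap.ker π).FG) (hV : Module.Baer H (RightDual k H V)) :
    Module.Projective Hᵐᵒᵖ V := by
  obtain ⟨S, hS⟩ := hK
  obtain ⟨θ, hθ, hθS⟩ := exists_endomorphism_fixing_list π hπ hV S.toList fun u hu => by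
    have : u ∈ LinearMap.ker π := hS ▸ Submodule.subset_span (by simpa using hu)
    exact this
  -- Thus `1 - θ` factors through `V`; since `π θ = 0`, the factorization is a section of `π`.
  have hker : LinearMap.ker π ≤ LinearMap.ker (LinearMap.id - θ) := by
    rw [← hS, Submodule.span_le]
    intro u hu
    simp [hθS u (by simpa using hu)]
  let e := π.quotKerEquivOfSurjective hπ
  refine Module.Projective.of_split
    ((LinearMap.ker π).liftQ (LinearMap.id - θ) hker ∘ₗ e.symm.toLinearMap) π ?_
  ext v
  obtain ⟨x, rfl⟩ := hπ v
  have : e.symm (π x) = Submodule.Quotient.mk x := by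
    rw [LinearEquiv.symm_apply_eq]; rfl
  simp [this, hθ]

end Villamayor

end RightModules

set_option linter.unusedSectionVars false

/-! ### Convolution and the antipode. -/

section Convolution

variable {k H N : Type*} [Field k] [Ring H] [HopfAlgebra k H] [AddCommGroup N] [Module k N]
  (ρ : H →ₐ[k] Module.End k N)

/-- The linear map `t ↦ φ(t₁) · B(t₂)`, where `H` acts on `N` through `ρ`. -/
def convAct (φ : H →ₗ[k] H) (B : H →ₗ[k] N) : H →ₗ[k] N :=
  TensorProduct.lift ((ρ.toLinearMap ∘ₗ φ).compl₂ B) ∘ₗ Coalgebra.comul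

theorem convAct_apply (φ : H →ₗ[k] H) (B : H →ₗ[k] N) (t : H) :
    convAct ρ φ B t = TensorProduct.lift ((ρ.toLinearMap ∘ₗ φ).compl₂ B)
      (Coalgebra.comul (R := k) t) := rfl

/-- By coassociativity, the convolution algebra of endomorphisms of `H` acts on `Hom(H, N)`. -/
theorem convAct_convAct (φ ψ : H →ₗ[k] H) (B : H →ₗ[k] N) :
    convAct ρ φ (convAct ρ ψ B) =
      convAct ρ (LinearMap.mul' k H ∘ₗ TensorProduct.map φ ψ ∘ₗ Coalgebra.comul) B := by
  ext t
  let Ξ : H ⊗[k] (H ⊗[k] H) →ₗ[k] N :=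
    TensorProduct.lift ((ρ.toLinearMap ∘ₗ φ).compl₂
      (TensorProduct.lift ((ρ.toLinearMap ∘ₗ ψ).compl₂ B)))
  have h1 (u : H ⊗[k] H) : TensorProduct.lift ((ρ.toLinearMap ∘ₗ φ).compl₂ (convAct ρ ψ B)) u =
      Ξ (Coalgebra.comul.lTensor H u) := by
    induction u with
    | zero => simp
    | add x y hx hy => simp only [map_add, hx, hy]
    | tmul p q => rfl
  have h2 (v : H ⊗[k] H) (q : H) : Ξ (TensorProduct.assoc k H H H (v ⊗ₜ q)) =
      ρ (LinearMap.mul' k H (TensorProduct.map φ ψ v)) (B q) := by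
    induction v with
    | zero => simp
    | add x y hx hy => simp only [map_add, TensorProduct.add_tmul, hx, hy, LinearMap.add_apply]
    | tmul p r => simp [Ξ]
  have h3 (u : H ⊗[k] H) : TensorProduct.lift ((ρ.toLinearMap ∘ₗ
      (LinearMap.mul' k H ∘ₗ TensorProduct.map φ ψ ∘ₗ Coalgebra.comul)).compl₂ B) u =
      Ξ (TensorProduct.assoc k H H H (Coalgebra.comul.rTensor H u)) := by
    induction u with
    | zero => simp
    | add x y hx hy => simp only [map_add, hx, hy]
    | tmul p q => rw [LinearMap.rTensor_tmul, h2]; rfl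
  rw [convAct_apply, convAct_apply, h1, h3, Coalgebra.coassoc_apply]

theorem convAct_counit (B : H →ₗ[k] N) :
    convAct ρ (Algebra.linearMap k H ∘ₗ Coalgebra.counit) B = B := by
  ext t
  have (u : H ⊗[k] H) : TensorProduct.lift ((ρ.toLinearMap ∘ₗ
      (Algebra.linearMap k H ∘ₗ Coalgebra.counit)).compl₂ B) u =
      B (TensorProduct.lid k H (Coalgebra.counit.rTensor H u)) := by
    induction u with
    | zero => simp
    | add x y hx hy => simp only [map_add, hx, hy]
    | tmul p q => simp
  rw [convAct_apply, this, Coalgebra.rTensor_counit_comul]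
  simp

/-- The antipode is the convolution inverse of the identity. This identity and its mirror image
below make `convAct ρ LinearMap.id` bijective, which is the source of cofreeness. -/
theorem convAct_antipode_convAct_id (B : H →ₗ[k] N) :
    convAct ρ (HopfAlgebra.antipode k) (convAct ρ LinearMap.id B) = B := by
  rw [convAct_convAct]
  exact (congrArg (fun φ => convAct ρ φ B) HopfAlgebra.mul_antipode_rTensor_comul).trans
    (convAct_counit ρ B)

theorem convAct_id_convAct_antipode (B : H →ₗ[k] N) :
    convAct ρ LinearMap.id (convAct ρ (HopfAlgebra.antipode k) B) = B := by
  rw [convAct_convAct]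
  exact (congrArg (fun φ => convAct ρ φ B) HopfAlgebra.mul_antipode_lTensor_comul).trans
    (convAct_counit ρ B)

end Convolution

namespace ModuleAlgebra

open MulOpposite

variable {k H A : Type*} [Field k] [Ring H] [HopfAlgebra k H] [Ring A] [Algebra k A]

/-! ### The twisted modules `Hom(V, N)` and cofreeness of `Hom(H, N)`. -/

section TwistedHom

variable (M : ModuleAlgebra k H A) (V N : Type*)
  [AddCommGroup V] [Module k V] [Module Hᵐᵒᵖ V] [IsScalarTower k Hᵐᵒᵖ V]
  [AddCommGroup N] [Module k N] [Module M.Smash N] [IsScalarTower k M.Smash N]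

/-- The action of the smash product on the linear maps with values in `N` by postcomposition. -/
def postcomp : M.Smash →ₐ[k] Module.End k (V →ₗ[k] N) :=
  AlgHom.ofLinearMap (LinearMap.llcomp k V N N ∘ₗ (Algebra.lsmul k k N).toLinearMap)
    (by ext; simp) (by intro a b; ext; simp)

@[simp] theorem postcomp_apply (x : M.Smash) (f : V →ₗ[k] N) (v : V) :
    M.postcomp V N x f v = x • f v := rfl

theorem commute_postcomp_precompRight (x : M.Smash) (h : H) :
    Commute (M.postcomp V N x) (precompRight k V N h) := by
  refine LinearMap.ext fun f => ?_
  rfl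

/-- The action of `H ⊗ H` on the linear maps from a right `H`-module to a left `H`-module,
`((h ⊗ t) · f)(v) = h f(v t)`. -/
def bimoduleAction : H ⊗[k] H →ₐ[k] Module.End k (V →ₗ[k] N) :=
  Algebra.TensorProduct.lift ((M.postcomp V N).comp (Smash.inr M)) (precompRight k V N)
    fun h t => M.commute_postcomp_precompRight V N (Smash.inr M h) t

@[simp] theorem bimoduleAction_tmul (h t : H) (f : V →ₗ[k] N) (v : V) :
    M.bimoduleAction V N (h ⊗ₜ t) f v = Smash.inr M h • f (op t • v) :=
  LinearMap.congr_fun (LinearMap.congr_fun (Algebra.TensorProduct.lift_tmul _ _ _ h t) f) v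

/-- The action of the smash product on the linear maps `V → N`, where `A` acts on the values and
`(h · f)(v) = h₁ f(v h₂)`. -/
def twistedAction : M.Smash →ₐ[k] Module.End k (V →ₗ[k] N) :=
  Smash.lift M ((M.postcomp V N).comp (Smash.inl M))
    ((M.bimoduleAction V N).comp (Bialgebra.comulAlgHom k H)) (by
      intro h a
      -- Both sides send `f` to `v ↦ (h₁ · a) h₂ f(v h₃)`; `Φ` is this expression as a function of
      -- the iterated coproduct.
      let Φ : H ⊗[k] (H ⊗[k] H) →ₗ[k] Module.End k (V →ₗ[k] N) :=
        LinearMap.mul' k _ ∘ₗ TensorProduct.map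
          (((M.postcomp V N).comp (Smash.inl M)).toLinearMap ∘ₗ M.action.toLinearMap.flip a)
          (M.bimoduleAction V N).toLinearMap
      have h1 (u : H ⊗[k] H) : LinearMap.mul' k _ (TensorProduct.map
          (((M.postcomp V N).comp (Smash.inl M)).toLinearMap ∘ₗ M.action.toLinearMap.flip a)
          ((M.bimoduleAction V N).comp (Bialgebra.comulAlgHom k H)).toLinearMap u) =
          Φ (Coalgebra.comul.lTensor H u) := by
        induction u with
        | zero => simp
        | add x y hx hy => simp only [map_add, hx, hy]
        | tmul p q => rfl
      have h2 (v : H ⊗[k] H) (q : H) : Φ (TensorProduct.assoc k H H H (v ⊗ₜ q)) =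
          M.postcomp V N (LinearMap.mul' k M.Smash (TensorProduct.map ((Smash.inl M).toLinearMap ∘ₗ
            M.action.toLinearMap.flip a) (Smash.inr M).toLinearMap v)) * precompRight k V N q := by
        induction v with
        | zero => simp
        | add x y hx hy => simp only [map_add, TensorProduct.add_tmul, hx, hy, add_mul]
        | tmul p r =>
          ext f v
          simp [Φ]
      have h3 (u : H ⊗[k] H) : M.bimoduleAction V N u * M.postcomp V N (Smash.inl M a) =
          Φ (TensorProduct.assoc k H H H (Coalgebra.comul.rTensor H u)) := by
        induction u with
        | zero => simp
        | add x y hx hy => simp only [map_add, hx, hy, add_mul]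
        | tmul p q =>
          rw [LinearMap.rTensor_tmul, h2, ← Smash.inr_mul_inl]
          ext f v
          simp
      rw [h1, ← Coalgebra.coassoc_apply, ← h3]
      rfl)

/-- The linear maps `V → N` from a right `H`-module to a module over the smash product, a module
over the smash product for `(h · f)(v) = h₁ f(v h₂)`. -/
def TwistedHom (_M : ModuleAlgebra k H A) (V N : Type*)
    [AddCommGroup V] [Module k V] [AddCommGroup N] [Module k N] : Type _ :=
  V →ₗ[k] N

namespace TwistedHom

instance : AddCommGroup (M.TwistedHom V N) := inferInstanceAs (AddCommGroup (V →ₗ[k] N))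

instance : FunLike (M.TwistedHom V N) V N := inferInstanceAs (FunLike (V →ₗ[k] N) V N)

instance : LinearMapClass (M.TwistedHom V N) k V N :=
  inferInstanceAs (LinearMapClass (V →ₗ[k] N) k V N)

instance : Module M.Smash (M.TwistedHom V N) :=
  Module.compHom (V →ₗ[k] N) (M.twistedAction V N).toRingHom

variable {M V N}

/-- A linear map, as an element of the twisted module of linear maps. -/
def of (f : V →ₗ[k] N) : M.TwistedHom V N := f

@[simp] theorem of_apply (f : V →ₗ[k] N) (v : V) : of (M := M) f v = f v := rfl

/-- The underlying linear map. -/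
def toLinearMap (f : M.TwistedHom V N) : V →ₗ[k] N := f

@[simp] theorem toLinearMap_apply (f : M.TwistedHom V N) (v : V) : f.toLinearMap v = f v := rfl

@[simp] theorem toLinearMap_of (f : V →ₗ[k] N) : (of (M := M) f).toLinearMap = f := rfl

theorem smul_apply (x : M.Smash) (f : M.TwistedHom V N) (v : V) :
    (x • f) v = M.twistedAction V N x f.toLinearMap v := rfl

@[simp] theorem add_apply (f g : M.TwistedHom V N) (v : V) : (f + g) v = f v + g v := rfl

@[ext] theorem ext {f g : M.TwistedHom V N} (h : ∀ v, f v = g v) : f = g := DFunLike.ext _ _ h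

theorem inl_smul_apply (a : A) (f : M.TwistedHom V N) (v : V) :
    (Smash.inl M a • f) v = Smash.inl M a • f v := by
  rw [smul_apply, twistedAction, Smash.lift_inl]; rfl

theorem inr_smul_apply (h : H) (f : M.TwistedHom V N) (v : V) :
    (Smash.inr M h • f) v = M.bimoduleAction V N (Coalgebra.comul (R := k) h) f.toLinearMap v := by
  rw [smul_apply, twistedAction, Smash.lift_inr]; rfl

theorem tmul_smul_apply (a : A) (h : H) (f : M.TwistedHom V N) (v : V) :
    (Smash.tmul M a h • f) v = Smash.inl M a • (Smash.inr M h • f) v := by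
  rw [← Smash.inl_mul_inr, mul_smul, inl_smul_apply]

section map

variable {V' : Type*} [AddCommGroup V'] [Module k V'] [Module Hᵐᵒᵖ V']
  [IsScalarTower k Hᵐᵒᵖ V']

variable (N) in
/-- Precomposition with a map of right modules. -/
def map (φ : V →ₗ[Hᵐᵒᵖ] V') : M.TwistedHom V' N →ₗ[M.Smash] M.TwistedHom V N where
  toFun f := of (f.toLinearMap ∘ₗ φ.restrictScalars k)
  map_add' _ _ := rfl
  map_smul' x f := by
    ext v
    rw [RingHom.id_apply]
    change (x • f) (φ v) = _
    induction x using Smash.induction_on with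
    | zero => rw [zero_smul, zero_smul]; rfl
    | add x y hx hy => simp only [add_smul, add_apply, hx, hy]
    | tmul a h =>
      rw [tmul_smul_apply, tmul_smul_apply, inr_smul_apply, inr_smul_apply]
      congr 1
      induction Coalgebra.comul (R := k) h with
      | zero => simp
      | add x y hx hy => simp only [map_add, LinearMap.add_apply, hx, hy]
      | tmul p q =>
        rw [bimoduleAction_tmul, bimoduleAction_tmul, toLinearMap_of, LinearMap.comp_apply,
          LinearMap.restrictScalars_apply, map_smul φ]

@[simp] theorem map_apply (φ : V →ₗ[Hᵐᵒᵖ] V') (f : M.TwistedHom V' N) (v : V) :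
    map N φ f v = f (φ v) := rfl

end map

section cofree

variable (M N) in
/-- The action of `H` on a module over the smash product. -/
def hopfAction : H →ₐ[k] Module.End k N := (Algebra.lsmul k k N).comp (Smash.inr M)

/-- The values at `1` of the multiples of `f` form its convolution with the identity, from which the
antipode recovers `f`. -/
theorem inr_smul_apply_one (h : H) (f : M.TwistedHom Hᵐᵒᵖ N) :
    (Smash.inr M h • f) 1 = convAct (hopfAction M N) LinearMap.id
      (f.toLinearMap ∘ₗ (opLinearEquiv k).toLinearMap) h := by
  rw [inr_smul_apply, convAct_apply]
  induction Coalgebra.comul (R := k) h with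
  | zero => simp
  | add x y hx hy => simp only [map_add, LinearMap.add_apply, hx, hy]
  | tmul p q =>
    rw [bimoduleAction_tmul, smul_eq_mul, mul_one]; rfl

/-- An element `f` of the twisted module `Hom(H, N)` is determined by the values of its multiples
at `1`. -/
theorem ext_smul_one {f g : M.TwistedHom Hᵐᵒᵖ N} (hfg : ∀ x : M.Smash, (x • f) 1 = (x • g) 1) :
    f = g := by
  have : f.toLinearMap ∘ₗ (opLinearEquiv k).toLinearMap =
      g.toLinearMap ∘ₗ (opLinearEquiv k).toLinearMap := by
    rw [← convAct_antipode_convAct_id (hopfAction M N)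
        (f.toLinearMap ∘ₗ (opLinearEquiv k).toLinearMap),
      ← convAct_antipode_convAct_id (hopfAction M N)
        (g.toLinearMap ∘ₗ (opLinearEquiv k).toLinearMap)]
    congr 1
    ext h
    rw [← inr_smul_apply_one, ← inr_smul_apply_one, hfg]
  ext v
  exact LinearMap.congr_fun this (unop v)

variable {X Y : Type*} [AddCommGroup X] [Module k X] [Module M.Smash X] [IsScalarTower k M.Smash X]

/-- The twisted module `Hom(H, N)` is cofree: an `A`-linear map `X → N` is the value at `1` of an
`A ⋊ H`-linear map `X → Hom(H, N)`. -/
theorem exists_lift_apply_one (g : X →ₗ[k] N)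
    (hg : ∀ a x, g (Smash.inl M a • x) = Smash.inl M a • g x) :
    ∃ G : X →ₗ[M.Smash] M.TwistedHom Hᵐᵒᵖ N, ∀ x, G x 1 = g x := by
  let B (x : X) : H →ₗ[k] N := g ∘ₗ (LinearMap.toSpanSingleton M.Smash X x).restrictScalars k ∘ₗ
    (Smash.inr M).toLinearMap
  -- The only candidate: linearity and `G x 1 = g x` prescribe the convolution of the identity with
  -- `G x` to be `h ↦ g (h x)`.
  let G (x : X) : M.TwistedHom Hᵐᵒᵖ N := of (convAct (hopfAction M N) (HopfAlgebra.antipode k)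
    (B x) ∘ₗ (opLinearEquiv k).symm.toLinearMap)
  have hG (y : M.Smash) (x : X) : (y • G x) 1 = g (y • x) := by
    induction y using Smash.induction_on with
    | zero => rw [zero_smul, zero_smul, map_zero]; rfl
    | add y z hy hz => simp only [add_smul, add_apply, hy, hz, map_add]
    | tmul a h =>
      rw [tmul_smul_apply, inr_smul_apply_one, ← Smash.inl_mul_inr, mul_smul, hg]
      congr 1
      have : (G x).toLinearMap ∘ₗ (opLinearEquiv k).toLinearMap =
          convAct (hopfAction M N) (HopfAlgebra.antipode k) (B x) := by
        ext; rfl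
      rw [this, convAct_id_convAct_antipode]
      rfl
  refine ⟨{ toFun := G, map_add' x y := ?_, map_smul' y x := ?_ }, fun x => ?_⟩
  · exact ext_smul_one fun z => by rw [smul_add, add_apply, hG, hG, hG, smul_add, map_add]
  · exact ext_smul_one fun z => by
      rw [RingHom.id_apply, hG, ← mul_smul, ← mul_smul, hG]
  · have := hG 1 x
    rwa [one_smul, one_smul] at this

variable [AddCommGroup Y] [Module k Y] [Module M.Smash Y] [IsScalarTower k M.Smash Y]

/-- If `A`-linear maps to `N` extend along `i : X → Y`, then so do `A ⋊ H`-linear maps to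
`Hom(V, N)` when the right `H`-module `V` is finitely generated projective. -/
theorem exists_extension [Module.Finite Hᵐᵒᵖ V] [Module.Projective Hᵐᵒᵖ V] (i : X →ₗ[M.Smash] Y)
    (hi : ∀ g : X →ₗ[k] N, (∀ a x, g (Smash.inl M a • x) = Smash.inl M a • g x) →
      ∃ g' : Y →ₗ[k] N, (∀ a y, g' (Smash.inl M a • y) = Smash.inl M a • g' y) ∧
        ∀ x, g' (i x) = g x)
    (f : X →ₗ[M.Smash] M.TwistedHom V N) :
    ∃ f' : Y →ₗ[M.Smash] M.TwistedHom V N, ∀ x, f' (i x) = f x := by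
  obtain ⟨n, p, s, -, -, hps⟩ := Module.Finite.exists_comp_eq_id_of_projective Hᵐᵒᵖ V
  -- As `V` is a retract of a free module, it suffices to extend the composites of `f` with these
  -- maps into `Hom(H, N)` and reassemble them with the coordinates of `s`.
  let c (l : Fin n) : Hᵐᵒᵖ →ₗ[Hᵐᵒᵖ] V := LinearMap.toSpanSingleton _ _ (p (Pi.single l 1))
  have key (l : Fin n) : ∃ F : Y →ₗ[M.Smash] M.TwistedHom Hᵐᵒᵖ N,
      ∀ x, F (i x) = map N (c l) (f x) := by
    let g : X →ₗ[k] N :=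
      { toFun x := f x (p (Pi.single l 1))
        map_add' x y := by rw [map_add]; rfl
        map_smul' a x := by
          rw [← algebraMap_smul M.Smash, map_smul, ← AlgHom.commutes (Smash.inl M),
            inl_smul_apply, AlgHom.commutes, algebraMap_smul]
          rfl }
    obtain ⟨g', hg', hgi⟩ := hi g fun a x => by
      change f _ _ = _ • f _ _
      rw [map_smul, inl_smul_apply]
    obtain ⟨F, hF⟩ := exists_lift_apply_one g' hg'
    refine ⟨F, fun x => ext_smul_one fun y => ?_⟩
    rw [← map_smul, ← map_smul, hF, hgi, ← map_smul, ← map_smul, map_apply]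
    simp [c, g]
  choose F hF using key
  refine ⟨∑ l, map N (LinearMap.proj l ∘ₗ s) ∘ₗ F l, fun x => ?_⟩
  have hsum (v : V) (t : Finset (Fin n)) :
      ((∑ l ∈ t, map N (LinearMap.proj l ∘ₗ s) ∘ₗ F l) (i x)) v =
        ∑ l ∈ t, f x (s v l • p (Pi.single l 1)) := by
    induction t using Finset.induction_on with
    | empty => rfl
    | insert l t hl ih =>
      rw [Finset.sum_insert hl, Finset.sum_insert hl, ← ih, LinearMap.add_apply, add_apply,
        LinearMap.comp_apply, hF]
      rfl
  ext v
  rw [hsum, ← map_sum]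
  congr 1
  conv_rhs => rw [show v = p (s v) from (LinearMap.congr_fun hps v).symm,
    ← Finset.univ_sum_single (s v), map_sum]
  refine Finset.sum_congr rfl fun l _ => ?_
  rw [← map_smul, ← Pi.single_smul, smul_eq_mul, mul_one]

end cofree

end TwistedHom

end TwistedHom

end ModuleAlgebra

/-! ### The trivial right module, which recovers `N` as `Hom(k, N)`. -/

section TrivialRightModule

open MulOpposite

/-- The trivial right `H`-module. -/
def TrivialRightModule (k H : Type*) [Field k] [Ring H] [HopfAlgebra k H] : Type _ := k

namespace TrivialRightModule

variable (k H : Type*) [Field k] [Ring H] [HopfAlgebra k H]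

instance : AddCommGroup (TrivialRightModule k H) := inferInstanceAs (AddCommGroup k)

instance : Module k (TrivialRightModule k H) := inferInstanceAs (Module k k)

/-- The opposite of the counit. -/
def opCounit : Hᵐᵒᵖ →+* k :=
  RingHom.fromOpposite (Bialgebra.counitAlgHom k H).toRingHom fun _ _ => Commute.all _ _

instance : Module Hᵐᵒᵖ (TrivialRightModule k H) := Module.compHom k (opCounit k H)

/-- The generator of the trivial right module. -/
def one : TrivialRightModule k H := (1 : k)

/-- The trivial right module, as a vector space, is the ground field. -/
def toScalar : TrivialRightModule k H ≃ₗ[k] k := LinearEquiv.refl k k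

theorem exists_smul_one (v : TrivialRightModule k H) : ∃ a : k, a • one k H = v :=
  ⟨v, mul_one (show k from v)⟩

variable {k H} in
theorem op_smul (h : H) (v : TrivialRightModule k H) :
    op h • v = Coalgebra.counit (R := k) h • v := rfl

instance : IsScalarTower k Hᵐᵒᵖ (TrivialRightModule k H) where
  smul_assoc a h v := by
    induction h using MulOpposite.rec' with
    | h h => rw [← MulOpposite.op_smul, op_smul, op_smul, map_smul, smul_assoc]

instance : Module.Finite Hᵐᵒᵖ (TrivialRightModule k H) := by
  refine ⟨⟨{one k H}, top_le_iff.1 fun v _ => ?_⟩⟩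
  rw [Finset.coe_singleton]
  obtain ⟨a, rfl⟩ := exists_smul_one k H v
  refine Submodule.mem_span_singleton.2 ⟨op (algebraMap k H a), ?_⟩
  rw [op_smul, Bialgebra.counit_algebraMap]

end TrivialRightModule

namespace ModuleAlgebra.TwistedHom

variable {k H A : Type*} [Field k] [Ring H] [HopfAlgebra k H] [Ring A] [Algebra k A]
  (M : ModuleAlgebra k H A) (N : Type*)
  [AddCommGroup N] [Module k N] [Module M.Smash N] [IsScalarTower k M.Smash N]

/-- The module of linear maps from the trivial right module to `N` is `N`. -/
def trivialEquiv : M.TwistedHom (TrivialRightModule k H) N ≃ₗ[M.Smash] N where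
  toFun f := f (TrivialRightModule.one k H)
  invFun n := of (LinearMap.toSpanSingleton k N n ∘ₗ
    (TrivialRightModule.toScalar k H).toLinearMap)
  left_inv f := by
    ext v
    obtain ⟨a, rfl⟩ := TrivialRightModule.exists_smul_one k H v
    rw [map_smul, map_smul]
    exact congrArg (a • ·) (one_smul k _)
  right_inv n := one_smul k n
  map_add' _ _ := rfl
  map_smul' x f := by
    rw [RingHom.id_apply]
    induction x using Smash.induction_on with
    | zero => rw [zero_smul, zero_smul]; rfl
    | add x y hx hy => simp only [add_smul, add_apply, hx, hy]
    | tmul a h =>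
      rw [tmul_smul_apply, ← Smash.inl_mul_inr, mul_smul, inr_smul_apply]
      congr 1
      -- On the trivial module the second tensor factor acts through the counit, so `h₁ f(1 · h₂) =
      -- h f(1)`.
      have (u : H ⊗[k] H) : M.bimoduleAction (TrivialRightModule k H) N u f.toLinearMap (TrivialRightModule.one k H) =
          Smash.inr M (TensorProduct.rid k H (Coalgebra.counit.lTensor H u)) • f (TrivialRightModule.one k H) := by
        induction u with
        | zero => simp
        | add x y hx hy => simp only [map_add, LinearMap.add_apply, hx, hy, add_smul]
        | tmul p q =>
          rw [bimoduleAction_tmul, TrivialRightModule.op_smul]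
          simp only [LinearMap.lTensor_tmul, TensorProduct.rid_tmul, map_smul]
          rw [toLinearMap_apply, smul_assoc, smul_comm]
      rw [this, Coalgebra.lTensor_counit_comul]
      simp

end ModuleAlgebra.TwistedHom

end TrivialRightModule

section ExactSequences

variable {k V Ω F N : Type*} [Field k] [AddCommGroup V] [Module k V] [AddCommGroup F] [Module k F]
  [AddCommGroup N] [Module k N]

theorem LinearMap.exists_comp_eq_of_surjective {π : F →ₗ[k] V} (hπ : Function.Surjective π)
    {g : F →ₗ[k] N} (hg : ∀ x, π x = 0 → g x = 0) : ∃ f : V →ₗ[k] N, f ∘ₗ π = g := by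
  obtain ⟨s, hs⟩ := LinearMap.exists_rightInverse_of_surjective π (LinearMap.range_eq_top.2 hπ)
  refine ⟨g ∘ₗ s, LinearMap.ext fun x => ?_⟩
  rw [LinearMap.comp_apply, LinearMap.comp_apply, ← sub_eq_zero, ← map_sub]
  refine hg _ ?_
  rw [map_sub, sub_eq_zero]
  exact LinearMap.congr_fun hs (π x)

theorem LinearMap.exists_comp_eq_of_injective [AddCommGroup Ω] [Module k Ω] {i : Ω →ₗ[k] F}
    (hi : Function.Injective i) (g : Ω →ₗ[k] N) : ∃ f : F →ₗ[k] N, f ∘ₗ i = g := by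
  obtain ⟨r, hr⟩ := LinearMap.exists_leftInverse_of_injective i (LinearMap.ker_eq_bot.2 hi)
  exact ⟨g ∘ₗ r, by rw [LinearMap.comp_assoc, hr, LinearMap.comp_id]⟩

end ExactSequences

theorem ModuleCat.restrictScalars_map_shortExact {R S : Type*} [Ring R] [Ring S] (f : R →+* S)
    {C : ShortComplex (ModuleCat.{v} S)} (hC : C.ShortExact) :
    (C.map (ModuleCat.restrictScalars.{v} f)).ShortExact :=
  ModuleCat.shortComplex_shortExact _
    ((ShortComplex.ShortExact.moduleCat_exact_iff_function_exact C).1 hC.exact)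
    hC.moduleCat_injective_f hC.moduleCat_surjective_g

/-- Restriction of scalars along a ring homomorphism `R → S` that makes `S` a projective left
`R`-module preserves projective objects. -/
theorem ModuleCat.projective_restrictScalars_obj {R S : Type u} [Ring R] [Ring S] (f : R →+* S)
    [Module.Projective R ((ModuleCat.restrictScalars f).obj (ModuleCat.of S S))]
    (P : ModuleCat.{u} S) [Projective P] : Projective ((ModuleCat.restrictScalars.{u} f).obj P) := by
  -- Coextension is `Hom_R(S, -)`, which preserves surjections as `S` is `R`-projective; its left
  -- adjoint, restriction, then preserves projectives.
  have : (ModuleCat.coextendScalars.{u, u, u} f).PreservesEpimorphisms := by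
    refine ⟨fun {X Y} g hg => ?_⟩
    rw [ModuleCat.epi_iff_surjective] at hg ⊢
    intro h
    obtain ⟨h', hh'⟩ := Module.projective_lifting_property g.hom
      (show (ModuleCat.restrictScalars f).obj (ModuleCat.of S S) →ₗ[R] Y from h) hg
    exact ⟨h', hh'⟩
  exact (ModuleCat.restrictCoextendScalarsAdj.{u, u, u} f).map_projective P inferInstance

/-! ### Finite global dimension of the smash product. -/

namespace ModuleAlgebra

open MulOpposite

variable {k H A : Type u} [Field k] [Ring H] [HopfAlgebra k H] [Ring A] [Algebra k A]
  (M : ModuleAlgebra k H A)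

/-- Restriction of modules over the smash product to the module algebra. -/
abbrev restrict : ModuleCat.{u} M.Smash ⥤ ModuleCat.{u} A :=
  ModuleCat.restrictScalars.{u} (Smash.inl M).toRingHom

instance : Module.Projective A (M.restrict.obj (ModuleCat.of M.Smash M.Smash)) := by
  let e : A ⊗[k] H ≃+ M.restrict.obj (ModuleCat.of M.Smash M.Smash) :=
    (Smash.equivTensor M).symm.toAddEquiv
  have he (a : A) (x : A ⊗[k] H) : e (a • x) = a • e x := by
    induction x with
    | zero => rw [smul_zero, map_zero, smul_zero]
    | add x y hx hy => rw [smul_add, map_add, map_add, hx, hy, smul_add]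
    | tmul b h => exact (Smash.inl_mul_tmul M a b h).symm
  exact Module.Projective.of_equiv (e.toLinearEquiv he)

section Vanishing

open scoped ModuleCat
open Abelian

variable (V : Type u) [AddCommGroup V] [Module k V] [Module Hᵐᵒᵖ V] [IsScalarTower k Hᵐᵒᵖ V]
  (N : ModuleCat.{u} M.Smash)

/-- The twisted module of linear maps `V → N`. -/
abbrev twistedHomCat : ModuleCat.{u} M.Smash := ModuleCat.of M.Smash (M.TwistedHom V N)

/-- The sequence splits over `A`, so `A`-linear maps to `N` extend by composition with a retraction,
and cofreeness promotes this to `A ⋊ H`-linear maps into `Hom(V, N)`. -/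
theorem exists_comp_eq_of_projective_restrict [Module.Finite Hᵐᵒᵖ V] [Module.Projective Hᵐᵒᵖ V]
    {C : ShortComplex (ModuleCat.{u} M.Smash)} (hC : C.ShortExact)
    (hX : Projective (M.restrict.obj C.X₃)) (φ : C.X₁ ⟶ M.twistedHomCat V N) :
    ∃ ψ : C.X₂ ⟶ M.twistedHomCat V N, C.f ≫ ψ = φ := by
  have hC' := ModuleCat.restrictScalars_map_shortExact (Smash.inl M).toRingHom hC
  have : Projective (C.map (ModuleCat.restrictScalars.{u} (Smash.inl M).toRingHom)).X₃ := hX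
  let s := hC'.splittingOfProjective
  have hs (x : C.X₁) : s.r.hom (C.f.hom x) = x :=
    LinearMap.congr_fun (congrArg ModuleCat.Hom.hom s.f_r) x
  have hr (a : A) (y : C.X₂) : (show C.X₁ from s.r.hom (Smash.inl M a • y)) =
      Smash.inl M a • (show C.X₁ from s.r.hom y) := s.r.hom.map_smul a y
  let r : C.X₂ →ₗ[k] C.X₁ :=
    { toFun y := s.r.hom y
      map_add' x y := s.r.hom.map_add x y
      map_smul' c y := by
        have := hr (algebraMap k A c) y
        rw [AlgHom.commutes, algebraMap_smul, algebraMap_smul] at this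
        exact this }
  obtain ⟨f', hf'⟩ := TwistedHom.exists_extension C.f.hom (N := N)
    (fun g hg => ⟨g ∘ₗ r, fun a y => by
        rw [LinearMap.comp_apply, LinearMap.comp_apply, ← hg]
        exact congrArg g (hr a y), fun x => congrArg g (hs x)⟩) φ.hom
  exact ⟨ModuleCat.ofHom f', by ext x; exact hf' x⟩

/-- Dimension shifting in `X`: projective `A ⋊ H`-modules are `A`-projective, hence so are the
syzygies of `X`. In degree one, every class is a pushout of the extension along a map that extends
to the middle term. -/
theorem ext_eq_zero_of_projective_restrict [Module.Finite Hᵐᵒᵖ V] [Module.Projective Hᵐᵒᵖ V]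
    (i : ℕ) (X : ModuleCat.{u} M.Smash) (hX : Projective (M.restrict.obj X))
    (e : Ext X (M.twistedHomCat V N) (i + 1)) : e = 0 := by
  induction i generalizing X with
  | zero =>
    have hC := X.shortExact_projectiveShortComplex
    obtain ⟨y, rfl⟩ := Ext.contravariant_sequence_exact₃ hC _ e
      (Ext.eq_zero_of_projective _) (add_comm 1 0)
    obtain ⟨φ, rfl⟩ := Ext.homEquiv₀.symm.surjective y
    obtain ⟨ψ, rfl⟩ := M.exists_comp_eq_of_projective_restrict V N hC hX φ
    rw [Ext.homEquiv₀_symm_apply, ← Ext.mk₀_comp_mk₀, hC.extClass_comp_assoc]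
  | succ i ih =>
    have hC := X.shortExact_projectiveShortComplex
    obtain ⟨y, rfl⟩ := Ext.contravariant_sequence_exact₃ hC _ e
      (Ext.eq_zero_of_projective _) (add_comm 1 (i + 1))
    have hC' := ModuleCat.restrictScalars_map_shortExact (Smash.inl M).toRingHom hC
    have : Projective X.projectiveShortComplex.X₂ :=
      inferInstance
    have h2 := ModuleCat.projective_restrictScalars_obj (Smash.inl M).toRingHom
      X.projectiveShortComplex.X₂
    rw [ih _ (projective_iff_hasProjectiveDimensionLT_one.2
      (hC'.hasProjectiveDimensionLT_X₁ 1 (projective_iff_hasProjectiveDimensionLT_one.1 h2)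
        (hasProjectiveDimensionLT_of_ge (M.restrict.obj X) 1 2 (by lia)))) y, Ext.comp_zero]

/-- The dual of a short exact sequence of right modules. -/
theorem _root_.RightDual.exists_shortExact {V : Type u} [AddCommGroup V] [Module k V]
    [Module Hᵐᵒᵖ V] [IsScalarTower k Hᵐᵒᵖ V] {F : Type u} [AddCommGroup F] [Module k F]
    [Module Hᵐᵒᵖ F] [IsScalarTower k Hᵐᵒᵖ F] (π : F →ₗ[Hᵐᵒᵖ] V) (hπ : Function.Surjective π) :
    ∃ (C : ShortComplex (ModuleCat.{u} H)), C.ShortExact ∧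
      C.X₁ = ModuleCat.of H (RightDual k H V) ∧ C.X₂ = ModuleCat.of H (RightDual k H F) ∧
      C.X₃ = ModuleCat.of H (RightDual k H (LinearMap.ker π)) := by
  refine ⟨ModuleCat.shortComplexOfCompEqZero (RightDual.map (k := k) π)
    (RightDual.map (k := k) (LinearMap.ker π).subtype) ?_, ?_, rfl, rfl, rfl⟩
  · ext f x
    simp only [LinearMap.comp_apply, RightDual.map_apply, Submodule.subtype_apply,
      LinearMap.map_coe_ker]
    exact map_zero f
  · refine ModuleCat.shortComplex_shortExact _ (fun g => ⟨fun hg => ?_, ?_⟩) (fun f g hfg => ?_)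
      (fun g => ?_)
    · obtain ⟨f, hf⟩ := LinearMap.exists_comp_eq_of_surjective (π := π.restrictScalars k) hπ
        (g := (show F →ₗ[k] k from g)) fun x hx =>
          DFunLike.congr_fun (F := RightDual k H (LinearMap.ker π)) hg ⟨x, hx⟩
      exact ⟨f, hf⟩
    · rintro ⟨f, rfl⟩
      refine RightDual.ext (k := k) (H := H) fun x => ?_
      change f (π x) = 0
      rw [LinearMap.map_coe_ker]
      exact map_zero f
    · refine RightDual.ext (k := k) (H := H) fun v => ?_
      obtain ⟨x, rfl⟩ := hπ v
      exact congrArg (fun f : RightDual k H F => f x) hfg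
    · obtain ⟨f, hf⟩ := LinearMap.exists_comp_eq_of_injective
        (i := (LinearMap.ker π).subtype.restrictScalars k)
        (LinearMap.ker π).injective_subtype (show LinearMap.ker π →ₗ[k] k from g)
      exact ⟨f, hf⟩

/-- The exact sequence of twisted modules of linear maps obtained from a short exact sequence of
right modules. -/
theorem TwistedHom.exists_shortExact {V : Type u} [AddCommGroup V] [Module k V]
    [Module Hᵐᵒᵖ V] [IsScalarTower k Hᵐᵒᵖ V] {F : Type u} [AddCommGroup F] [Module k F]
    [Module Hᵐᵒᵖ F] [IsScalarTower k Hᵐᵒᵖ F] (π : F →ₗ[Hᵐᵒᵖ] V) (hπ : Function.Surjective π) :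
    ∃ (C : ShortComplex (ModuleCat.{u} M.Smash)), C.ShortExact ∧
      C.X₁ = M.twistedHomCat V N ∧ C.X₂ = M.twistedHomCat F N ∧
      C.X₃ = M.twistedHomCat (LinearMap.ker π) N := by
  refine ⟨ModuleCat.shortComplexOfCompEqZero (TwistedHom.map N π)
    (TwistedHom.map N (LinearMap.ker π).subtype) ?_, ?_, rfl, rfl, rfl⟩
  · ext f x
    simp only [LinearMap.comp_apply, TwistedHom.map_apply, Submodule.subtype_apply,
      LinearMap.map_coe_ker]
    exact map_zero f
  · refine ModuleCat.shortComplex_shortExact _ (fun g => ⟨fun hg => ?_, ?_⟩) (fun f g hfg => ?_)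
      (fun g => ?_)
    · obtain ⟨f, hf⟩ := LinearMap.exists_comp_eq_of_surjective (π := π.restrictScalars k) hπ
        (g := TwistedHom.toLinearMap g) fun x hx =>
          congrArg (fun f : M.TwistedHom (LinearMap.ker π) N => f ⟨x, hx⟩) hg
      exact ⟨f, hf⟩
    · rintro ⟨f, rfl⟩
      refine TwistedHom.ext (M := M) (N := N) fun x => ?_
      change f (π x) = 0
      rw [LinearMap.map_coe_ker]
      exact map_zero f
    · refine TwistedHom.ext (M := M) (N := N) fun v => ?_
      obtain ⟨x, rfl⟩ := hπ v
      exact congrArg (fun f : M.TwistedHom F N => f x) hfg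
    · obtain ⟨f, hf⟩ := LinearMap.exists_comp_eq_of_injective
        (i := (LinearMap.ker π).subtype.restrictScalars k)
        (LinearMap.ker π).injective_subtype
        (TwistedHom.toLinearMap (M := M) (V := LinearMap.ker π) (N := N) g)
      exact ⟨f, hf⟩

/-- If the dual of the right module `V` has injective dimension at most `n`, then `Ext` groups in
degrees above `n` with values in the twisted module of linear maps `V → N` vanish on the modules
that are projective over the module algebra. -/
theorem ext_eq_zero_of_injectiveDimension [IsNoetherianRing Hᵐᵒᵖ] (n : ℕ) (V : Type u)
    [AddCommGroup V] [Module k V] [Module Hᵐᵒᵖ V] [IsScalarTower k Hᵐᵒᵖ V] [Module.Finite Hᵐᵒᵖ V]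
    (hV : HasInjectiveDimensionLE (ModuleCat.of H (RightDual k H V)) n)
    (X : ModuleCat.{u} M.Smash) (hX : Projective (M.restrict.obj X)) (i : ℕ) (hi : n < i)
    (e : Ext X (M.twistedHomCat V N) i) : e = 0 := by
  obtain ⟨i, rfl⟩ : ∃ l, i = l + 1 := ⟨i - 1, by lia⟩
  obtain ⟨r, π, hπ⟩ := Module.Finite.exists_fin' Hᵐᵒᵖ V
  induction n generalizing V i r with
  | zero =>
    have h1 : Injective (ModuleCat.of H (RightDual k H V)) :=
      injective_iff_hasInjectiveDimensionLT_one.2 hV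
    have h2 : Module.Injective H (RightDual k H V) :=
      (Module.injective_iff_injective_object H _).2 h1
    -- Here left-module information (an injective dual) becomes right-module information.
    have := Module.Projective.of_rightDual_injective π hπ (IsNoetherian.noetherian _)
      (Module.Baer.of_injective h2)
    exact M.ext_eq_zero_of_projective_restrict V N i X hX e
  | succ n ih =>
    obtain ⟨i, rfl⟩ : ∃ l, i = l + 1 := ⟨i - 1, by lia⟩
    obtain ⟨C, hC, hC1, hC2, hC3⟩ := RightDual.exists_shortExact (k := k) π hπ
    obtain ⟨D, hD, hD1, hD2, hD3⟩ := TwistedHom.exists_shortExact M N π hπ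
    have h2 : Injective (ModuleCat.of H (RightDual k H (Fin r → Hᵐᵒᵖ))) :=
      (Module.injective_iff_injective_object H _).1 (RightDual.injective_pi.{u, u} r)
    -- The dual of the free module is injective, so the dual of the syzygy has injective dimension
    -- one lower.
    have hΩ : HasInjectiveDimensionLE (ModuleCat.of H (RightDual k H (LinearMap.ker π))) n :=
      hC3 ▸ (hC.hasInjectiveDimensionLT_X₃_iff n (hC2 ▸ h2)).2 (hC1 ▸ hV)
    obtain ⟨r', π', hπ'⟩ := Module.Finite.exists_fin' Hᵐᵒᵖ (LinearMap.ker π)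
    have hF (e : Ext X (M.twistedHomCat (Fin r → Hᵐᵒᵖ) N) (i + 2)) : e = 0 :=
      M.ext_eq_zero_of_projective_restrict _ N _ X hX e
    have hK (e : Ext X (M.twistedHomCat (LinearMap.ker π) N) (i + 1)) : e = 0 :=
      ih (LinearMap.ker π) hΩ i (by lia) e r' π' hπ'
    rw [← hD2] at hF
    rw [← hD3] at hK
    revert e
    rw [← hD1]
    intro e
    obtain ⟨y, rfl⟩ := Ext.covariant_sequence_exact₁ X hD e (hF _) rfl
    rw [hK y, Ext.zero_comp]

/-- The projective dimension of a module over the smash product that is projective over the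
module algebra is bounded by the global dimension of the Hopf algebra. -/
theorem hasProjectiveDimensionLE_of_projective_restrict [IsNoetherianRing Hᵐᵒᵖ] (n : ℕ)
    (hn : ∀ Y : ModuleCat.{u} H, HasProjectiveDimensionLE Y n)
    (X : ModuleCat.{u} M.Smash) (hX : Projective (M.restrict.obj X)) :
    HasProjectiveDimensionLE X n := by
  -- The left global dimension bounds the injective dimension of every left module, in particular of
  -- the dual of the trivial right module.
  have hV : HasInjectiveDimensionLE
      (ModuleCat.of H (RightDual k H (TrivialRightModule k H))) n :=
    HasInjectiveDimensionLT.mk fun i hi Y e =>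
      have := hn Y
      e.eq_zero_of_hasProjectiveDimensionLT (n + 1) hi
  refine HasProjectiveDimensionLT.mk fun i hi N e => ?_
  let φ : M.twistedHomCat (TrivialRightModule k H) N ≅ N :=
    (TwistedHom.trivialEquiv M N).toModuleIso
  rw [← e.comp_mk₀_id, ← φ.inv_hom_id, ← Ext.mk₀_comp_mk₀, ← Ext.comp_assoc_of_third_deg_zero,
    M.ext_eq_zero_of_injectiveDimension N n _ hV X hX i hi
      (e.comp (Ext.mk₀ φ.inv) (add_zero i)), Ext.zero_comp]

/-- Each syzygy over `A ⋊ H` restricts to a syzygy over `A` and lowers the `A`-dimension by one,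
down to the `A`-projective case. -/
theorem hasProjectiveDimensionLE_of_restrict [IsNoetherianRing Hᵐᵒᵖ] (n : ℕ)
    (hn : ∀ Y : ModuleCat.{u} H, HasProjectiveDimensionLE Y n) (d : ℕ)
    (X : ModuleCat.{u} M.Smash) (hX : HasProjectiveDimensionLE (M.restrict.obj X) d) :
    HasProjectiveDimensionLE X (n + d) := by
  induction d generalizing X with
  | zero =>
    exact M.hasProjectiveDimensionLE_of_projective_restrict n hn X
      (projective_iff_hasProjectiveDimensionLT_one.2 hX)
  | succ d ih =>
    have hC := X.shortExact_projectiveShortComplex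
    have hC' := ModuleCat.restrictScalars_map_shortExact (Smash.inl M).toRingHom hC
    have : Projective X.projectiveShortComplex.X₂ := inferInstance
    have h2 := ModuleCat.projective_restrictScalars_obj (Smash.inl M).toRingHom
      X.projectiveShortComplex.X₂
    exact (hC.hasProjectiveDimensionLT_X₃_iff (n + d) this).2
      (ih _ ((hC'.hasProjectiveDimensionLT_X₃_iff d h2).1 hX))

/-- The smash product of a module algebra and a Noetherian Hopf algebra, both of finite global
dimension, has finite global dimension. -/
theorem hasFiniteGlobalDimension_smash [IsNoetherianRing Hᵐᵒᵖ]
    (hA : HasFiniteGlobalDimension A) (hH : HasFiniteGlobalDimension H) :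
    HasFiniteGlobalDimension M.Smash := by
  obtain ⟨d, hd⟩ := hA
  obtain ⟨n, hn⟩ := hH
  exact ⟨n + d, fun X => M.hasProjectiveDimensionLE_of_restrict n hn d X (hd _)⟩

end Vanishing

end ModuleAlgebra

/-! ### Finiteness, projectivity and smoothness of tensor products. -/

section TensorProductModules

variable {k Z W Q H X : Type*} [Field k] [CommRing Z] [Algebra k Z] [CommRing W] [Algebra k W]
  [AddCommGroup Q] [Module k Q] [Module Z Q] [IsScalarTower k Z Q]
  [AddCommGroup H] [Module k H] [Module W H] [IsScalarTower k W H]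
  [AddCommGroup X] [Module (Z ⊗[k] W) X]

/-- The tensor product of a finite projective `Z`-module and a finite projective `W`-module is a
retract of a free `Z ⊗ W`-module of finite rank. -/
theorem exists_retract_of_tensor_addEquiv [Module.Finite Z Q] [Module.Projective Z Q]
    [Module.Finite W H] [Module.Projective W H] (e : Q ⊗[k] H ≃+ X)
    (he : ∀ (z : Z) (w : W) (q : Q) (h : H), e ((z • q) ⊗ₜ (w • h)) = (z ⊗ₜ[k] w) • e (q ⊗ₜ h)) :
    ∃ (n m : ℕ) (s : X →ₗ[Z ⊗[k] W] (Fin n × Fin m → Z ⊗[k] W))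
      (p : (Fin n × Fin m → Z ⊗[k] W) →ₗ[Z ⊗[k] W] X), p ∘ₗ s = LinearMap.id := by
  obtain ⟨n, p, s, -, -, hp⟩ := Module.Finite.exists_comp_eq_id_of_projective Z Q
  obtain ⟨m, p', s', -, -, hp'⟩ := Module.Finite.exists_comp_eq_id_of_projective W H
  have hsum (q : Q) : ∑ i, s q i • p (Pi.single i 1) = q := by
    conv_rhs => rw [← LinearMap.id_apply (R := Z) q, ← hp, LinearMap.comp_apply,
      ← Finset.univ_sum_single (s q), map_sum]
    exact Finset.sum_congr rfl fun i _ => by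
      rw [← map_smul, ← Pi.single_smul, smul_eq_mul, mul_one]
  have hsum' (h : H) : ∑ i, s' h i • p' (Pi.single i 1) = h := by
    conv_rhs => rw [← LinearMap.id_apply (R := W) h, ← hp', LinearMap.comp_apply,
      ← Finset.univ_sum_single (s' h), map_sum]
    exact Finset.sum_congr rfl fun i _ => by
      rw [← map_smul, ← Pi.single_smul, smul_eq_mul, mul_one]
  -- Products of the coordinates of the two retractions; the dual generators are the tensors of the
  -- given generators.
  let c (l : Fin n × Fin m) : Q ⊗[k] H →ₗ[k] Z ⊗[k] W :=
    TensorProduct.map ((LinearMap.proj l.1 ∘ₗ s).restrictScalars k)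
      ((LinearMap.proj l.2 ∘ₗ s').restrictScalars k)
  have hc (l) (q : Q) (h : H) : c l (q ⊗ₜ h) = s q l.1 ⊗ₜ s' h l.2 := rfl
  have hlin (a : Z ⊗[k] W) (x : Q ⊗[k] H) (l) : c l (e.symm (a • e x)) = a * c l x := by
    induction a with
    | zero => simp
    | add a b ha hb => simp only [add_smul, map_add, ha, hb, add_mul]
    | tmul z w =>
      induction x with
      | zero => simp
      | add x y hx hy => simp only [map_add, smul_add, mul_add, hx, hy]
      | tmul q h =>
        rw [← he, AddEquiv.symm_apply_apply, hc, hc, map_smul, map_smul]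
        exact (Algebra.TensorProduct.tmul_mul_tmul z (s q l.1) w (s' h l.2)).symm
  refine ⟨n, m, LinearMap.pi fun l => { toFun x := c l (e.symm x), map_add' := ?_, map_smul' := ?_ },
    Fintype.linearCombination _ fun l => e (p (Pi.single l.1 1) ⊗ₜ p' (Pi.single l.2 1)), ?_⟩
  · intro x y; rw [map_add, map_add]
  · intro a x
    obtain ⟨x, rfl⟩ := e.surjective x
    rw [hlin, AddEquiv.symm_apply_apply]
    rfl
  · ext x
    obtain ⟨x, rfl⟩ := e.surjective x
    simp only [LinearMap.comp_apply, Fintype.linearCombination_apply, LinearMap.pi_apply,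
      LinearMap.coe_mk, AddHom.coe_mk, AddEquiv.symm_apply_apply, LinearMap.id_apply]
    induction x with
    | zero => simp
    | add x y hx hy => simp only [map_add, add_smul, Finset.sum_add_distrib, hx, hy]
    | tmul q h =>
      simp only [hc, ← he, ← map_sum]
      rw [Fintype.sum_prod_type]
      simp only [← TensorProduct.tmul_sum, hsum', ← TensorProduct.sum_tmul, hsum]

theorem Module.Finite.of_tensor_addEquiv [Module.Finite Z Q] [Module.Projective Z Q]
    [Module.Finite W H] [Module.Projective W H] (e : Q ⊗[k] H ≃+ X)
    (he : ∀ (z : Z) (w : W) (q : Q) (h : H), e ((z • q) ⊗ₜ (w • h)) = (z ⊗ₜ[k] w) • e (q ⊗ₜ h)) :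
    Module.Finite (Z ⊗[k] W) X := by
  obtain ⟨n, m, s, p, hps⟩ := exists_retract_of_tensor_addEquiv e he
  exact Module.Finite.of_surjective p fun x => ⟨s x, LinearMap.congr_fun hps x⟩

theorem Module.Projective.of_tensor_addEquiv [Module.Finite Z Q] [Module.Projective Z Q]
    [Module.Finite W H] [Module.Projective W H] (e : Q ⊗[k] H ≃+ X)
    (he : ∀ (z : Z) (w : W) (q : Q) (h : H), e ((z • q) ⊗ₜ (w • h)) = (z ⊗ₜ[k] w) • e (q ⊗ₜ h)) :
    Module.Projective (Z ⊗[k] W) X := by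
  obtain ⟨n, m, s, p, hps⟩ := exists_retract_of_tensor_addEquiv e he
  exact Module.Projective.of_split s p hps

end TensorProductModules

/-- `Z ⊗ W` is smooth over `Z` by base change, and `Z` is smooth over `k`. -/
theorem Algebra.Smooth.tensorProduct {k Z W : Type*} [Field k] [CommRing Z] [Algebra k Z]
    [CommRing W] [Algebra k W] [Algebra.Smooth k Z] [Algebra.Smooth k W] :
    Algebra.Smooth k (Z ⊗[k] W) :=
  Algebra.Smooth.comp k Z (Z ⊗[k] W)

/-! ### Consequences of the deformation axioms. -/

section DeformationSequence

variable {k : Type u} {Z Q R : Type u} [Field k] [CommRing Z] [Algebra k Z]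
    [Ring Q] [Algebra k Q] [Ring R] [Algebra k R] {ι : Z →ₐ[k] Q} {π : Q →ₐ[k] R}
    {εZ : Z →ₐ[k] k} {εQ : Q →ₐ[k] k} {εR : R →ₐ[k] k}

namespace IsDeformationSequence

theorem isNoetherianRing (h : IsDeformationSequence ι π εZ εQ εR) : IsNoetherianRing Z :=
  have := h.finiteType
  Algebra.FiniteType.isNoetherianRing k Z

theorem projective (h : IsDeformationSequence ι π εZ εQ εR) :
    letI : Module Z Q := Module.compHom Q ι.toRingHom; Module.Projective Z Q := by
  let _ : Module Z Q := Module.compHom Q ι.toRingHom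
  have := h.isNoetherianRing
  have := h.finite
  have := h.flat
  have := Module.finitePresentation_of_finite Z Q
  exact Module.Flat.projective_of_finitePresentation

/-- Centrality of `Z` makes `Qᵐᵒᵖ` a finite algebra over a Noetherian ring. For `H` this keeps
syzygies of right modules finitely generated. -/
theorem isNoetherianRing_op (h : IsDeformationSequence ι π εZ εQ εR) :
    IsNoetherianRing Qᵐᵒᵖ := by
  let _ : Algebra Z Q := ι.toRingHom.toAlgebra' h.central
  have := h.isNoetherianRing
  have hfin : Module.Finite Z Q := h.finite
  have : Module.Finite Z Qᵐᵒᵖ := Module.Finite.equiv (MulOpposite.opLinearEquiv Z)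
  exact isNoetherianRing_iff.2 (isNoetherian_of_tower Z inferInstance)

theorem map_ι_eq_zero (h : IsDeformationSequence ι π εZ εQ εR) {z : Z} (hz : εZ z = 0) :
    π (ι z) = 0 := by
  have : ι z ∈ RingHom.ker π := by
    rw [h.ker_eq]
    exact Ideal.subset_span ⟨z, hz, rfl⟩
  exact this

theorem map_ι (h : IsDeformationSequence ι π εZ εQ εR) (z : Z) :
    π (ι z) = algebraMap k R (εZ z) := by
  have := h.map_ι_eq_zero (z := z - algebraMap k Z (εZ z)) (by simp)
  simpa [sub_eq_zero] using this

end IsDeformationSequence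

end DeformationSequence

/-! ### The inclusion, the projection and its kernel. -/

namespace IsEquivariantDeformationSequence

open ModuleAlgebra

variable {k : Type u} {W H Z Q R : Type u} [Field k]
    [CommRing W] [HopfAlgebra k W] [Ring H] [HopfAlgebra k H]
    [CommRing Z] [Algebra k Z] [Ring Q] [Algebra k Q] [Ring R] [Algebra k R]
    {j : W →ₐc[k] H} {ι : Z →ₐ[k] Q} {π : Q →ₐ[k] R}
    {εZ : Z →ₐ[k] k} {εQ : Q →ₐ[k] k} {εR : R →ₐ[k] k}
    {actZ : ModuleAlgebra k H Z} {actQ : ModuleAlgebra k H Q} {actR : ModuleAlgebra k H R}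
    (hM : IsEquivariantDeformationSequence j ι π εZ εQ εR actZ actQ actR)

include hM

theorem commute_inl_inr (z : Z) (h : H) :
    Commute (Smash.inl actQ (ι z)) (Smash.inr actQ h) :=
  Smash.commute_inl_inr (fun h => by rw [← hM.equivariant_ι, hM.trivial_Z, map_smul]) h

/-- The inclusion `ι ⋊ j` of `Z ⊗ W` in the smash product. -/
def smashInclusion : Z ⊗[k] W →ₐ[k] actQ.Smash :=
  Algebra.TensorProduct.lift ((Smash.inl actQ).comp ι) ((Smash.inr actQ).comp (j : W →ₐ[k] H))
    fun z w => hM.commute_inl_inr z (j w)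

theorem smashInclusion_tmul (z : Z) (w : W) :
    hM.smashInclusion (z ⊗ₜ w) = Smash.tmul actQ (ι z) (j w) :=
  (Algebra.TensorProduct.lift_tmul _ _ _ z w).trans (Smash.inl_mul_inr actQ (ι z) (j w))

theorem smashInclusion_left (z : Z) :
    hM.smashInclusion (z ⊗ₜ 1) = Smash.inl actQ (ι z) := by
  rw [smashInclusion_tmul, map_one]; rfl

theorem smashInclusion_right (w : W) :
    hM.smashInclusion (1 ⊗ₜ w) = Smash.inr actQ (j w) := by
  rw [smashInclusion_tmul, map_one]; rfl

theorem equivTensor_smashInclusion (x : Z ⊗[k] W) :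
    Smash.equivTensor actQ (hM.smashInclusion x) =
      TensorProduct.map ι.toLinearMap (j : W →ₗ[k] H) x := by
  induction x with
  | zero => simp
  | add x y hx hy => simp only [map_add, hx, hy]
  | tmul z w => rw [smashInclusion_tmul]; rfl

theorem smashInclusion_injective (hj : Function.Injective j) :
    Function.Injective hM.smashInclusion := by
  intro x y hxy
  refine TensorProduct.map_injective_of_flat_flat ι.toLinearMap (j : W →ₗ[k] H)
    hM.deformation.injective hj ?_
  rw [← hM.equivTensor_smashInclusion, ← hM.equivTensor_smashInclusion, hxy]

theorem smashInclusion_central (hj : ∀ (w : W) (h : H), j w * h = h * j w) (x : Z ⊗[k] W)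
    (y : actQ.Smash) : hM.smashInclusion x * y = y * hM.smashInclusion x := by
  change Commute _ _
  induction x with
  | zero => rw [map_zero]; exact Commute.zero_left _
  | add x x' hx hx' => rw [map_add]; exact hx.add_left hx'
  | tmul z w =>
    rw [smashInclusion_tmul, ← Smash.inl_mul_inr]
    induction y using Smash.induction_on with
    | zero => exact Commute.zero_right _
    | add y y' hy hy' => exact hy.add_right hy'
    | tmul q h =>
      rw [← Smash.inl_mul_inr]
      refine Commute.mul_left (Commute.mul_right ?_ (hM.commute_inl_inr z h))
        (Commute.mul_right (Smash.commute_inr_inl j hM.trivial_W w q) ?_)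
      · exact Commute.map (hM.deformation.central z q) (Smash.inl actQ)
      · exact Commute.map (hj w h) (Smash.inr actQ)

variable {K : Type u} [Ring K] [HopfAlgebra k K] {p : H →ₐc[k] K}

theorem action_eq_zero (hC : IsHopfExact j p) (h : H) (hp : p h = 0) : actR.action h = 0 := by
  have hmem : h ∈ Ideal.span (j '' (RingHom.ker (Bialgebra.counitAlgHom k W) : Set W)) :=
    hC.ker_eq ▸ hp
  clear hp
  induction hmem using Submodule.span_induction with
  | mem x hx =>
    obtain ⟨w, hw, rfl⟩ := hx
    refine LinearMap.ext fun r => ?_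
    obtain ⟨q, rfl⟩ := hM.deformation.surjective r
    rw [← hM.equivariant_π, hM.trivial_W w q, counit_bialgHom,
      show Coalgebra.counit (R := k) w = 0 from hw, zero_smul, map_zero]
    rfl
  | zero => rw [map_zero]
  | add x y _ _ hx hy => rw [map_add, hx, hy, add_zero]
  | smul a x _ hx => rw [smul_eq_mul, map_mul, hx, mul_zero]

/-- The `K`-module algebra structure on `R` induced by the `H`-module algebra structure. -/
def quotientAction (hC : IsHopfExact j p) : ModuleAlgebra k K R :=
  actR.descend p hC.surjective (hM.action_eq_zero hC)

theorem quotientAction_action (hC : IsHopfExact j p) (h : H) (q : Q) :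
    π (actQ.action h q) = (hM.quotientAction hC).action (p h) (π q) := by
  rw [quotientAction, descend_action, hM.equivariant_π]

theorem quotientAction_isAugmented (hC : IsHopfExact j p) :
    (hM.quotientAction hC).IsAugmented εR := by
  intro t r
  obtain ⟨h, rfl⟩ := hC.surjective t
  rw [quotientAction, descend_action, hM.augmented_R, counit_bialgHom]

/-- The projection `π ⋊ p` of smash products. -/
def smashProjection (hC : IsHopfExact j p) : actQ.Smash →ₐ[k] (hM.quotientAction hC).Smash :=
  Smash.map π p (hM.quotientAction_action hC)

theorem smashProjection_tmul (hC : IsHopfExact j p) (q : Q) (h : H) :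
    hM.smashProjection hC (Smash.tmul actQ q h) = Smash.tmul _ (π q) (p h) :=
  Smash.map_tmul _ _ _ _ _

theorem equivTensor_smashProjection (hC : IsHopfExact j p) (x : actQ.Smash) :
    Smash.equivTensor _ (hM.smashProjection hC x) =
      TensorProduct.map π.toLinearMap (p : H →ₗ[k] K) (Smash.equivTensor actQ x) := by
  induction x using Smash.induction_on with
  | zero => simp
  | add x y hx hy => simp only [map_add, hx, hy]
  | tmul q h => rw [smashProjection_tmul]; rfl

theorem smashProjection_surjective (hC : IsHopfExact j p) :
    Function.Surjective (hM.smashProjection hC) := by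
  intro y
  obtain ⟨x, hx⟩ := TensorProduct.map_surjective (g := π.toLinearMap) (g' := (p : H →ₗ[k] K))
    hM.deformation.surjective hC.surjective (Smash.equivTensor _ y)
  refine ⟨(Smash.equivTensor actQ).symm x, (Smash.equivTensor _).injective ?_⟩
  rw [equivTensor_smashProjection, LinearEquiv.apply_symm_apply, hx]

theorem smashProjection_smashInclusion (hC : IsHopfExact j p) (x : Z ⊗[k] W) :
    hM.smashProjection hC (hM.smashInclusion x) = algebraMap k _
      (Algebra.TensorProduct.lift εZ (Bialgebra.counitAlgHom k W) (fun _ _ => Commute.all _ _) x) := by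
  have hw (w : W) : p (j w) = algebraMap k K (Coalgebra.counit (R := k) w) := by
    have hmem : j (w - algebraMap k W (Coalgebra.counit (R := k) w)) ∈
        RingHom.ker (p : H →ₐ[k] K) := by
      refine hC.ker_eq ▸ Ideal.subset_span ⟨_, ?_, rfl⟩
      simp [RingHom.mem_ker]
    have h0 : p (j (w - algebraMap k W (Coalgebra.counit (R := k) w))) = 0 := hmem
    rw [map_sub, map_sub, sub_eq_zero] at h0
    rw [h0]
    exact (AlgHom.commutes ((p : H →ₐ[k] K).comp (j : W →ₐ[k] H)) _)
  induction x with
  | zero => simp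
  | add x y hx hy => simp only [map_add, hx, hy]
  | tmul z w =>
    rw [smashInclusion_tmul, smashProjection_tmul, hw, hM.deformation.map_ι,
      ← Smash.inl_mul_inr, AlgHom.commutes, AlgHom.commutes, ← map_mul]
    rfl

/-- Over a field, `ker (π ⊗ p) = ker π ⊗ H + Q ⊗ ker p`, and each summand lies in the left ideal.
The reverse inclusion holds because the composite of inclusion and projection is the augmentation.
-/
theorem ker_smashProjection (hC : IsHopfExact j p) :
    RingHom.ker (hM.smashProjection hC) = Ideal.span (hM.smashInclusion ''
      (RingHom.ker (Algebra.TensorProduct.lift εZ (Bialgebra.counitAlgHom k W)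
        (fun _ _ => Commute.all _ _)) : Set (Z ⊗[k] W))) := by
  refine le_antisymm (fun x hx => ?_) ?_
  · set I := Ideal.span (hM.smashInclusion ''
      (RingHom.ker (Algebra.TensorProduct.lift εZ (Bialgebra.counitAlgHom k W)
        (fun _ _ => Commute.all _ _)) : Set (Z ⊗[k] W))) with hI
    have hleft (q : Q) (hq : π q = 0) (h : H) : Smash.tmul actQ q h ∈ I := by
      have hmem : q ∈ Ideal.span (ι '' (RingHom.ker εZ : Set Z)) := hM.deformation.ker_eq ▸ hq
      clear hq
      rw [← Smash.inl_mul_inr]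
      induction hmem using Submodule.span_induction with
      | mem q hq =>
        obtain ⟨z, hz, rfl⟩ := hq
        -- The ideal is a left ideal, so `ι z` has to be moved to the right of `h`.
        rw [(hM.commute_inl_inr z h).eq, ← hM.smashInclusion_left]
        refine I.mul_mem_left _ (Ideal.subset_span ⟨_, ?_, rfl⟩)
        simp only [SetLike.mem_coe, RingHom.mem_ker] at hz ⊢
        rw [Algebra.TensorProduct.lift_tmul, hz, zero_mul]
      | zero => rw [map_zero, zero_mul]; exact I.zero_mem
      | add x y _ _ hx hy => rw [map_add, add_mul]; exact I.add_mem hx hy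
      | smul a x _ hx =>
        rw [smul_eq_mul, map_mul, mul_assoc]
        exact I.mul_mem_left _ hx
    have hright (q : Q) (h : H) (hh : p h = 0) : Smash.tmul actQ q h ∈ I := by
      have hmem : h ∈ Ideal.span (j '' (RingHom.ker (Bialgebra.counitAlgHom k W) : Set W)) :=
        hC.ker_eq ▸ hh
      clear hh
      rw [← Smash.inl_mul_inr]
      refine I.mul_mem_left _ ?_
      induction hmem using Submodule.span_induction with
      | mem h hh =>
        obtain ⟨w, hw, rfl⟩ := hh
        rw [← hM.smashInclusion_right]
        refine Ideal.subset_span ⟨_, ?_, rfl⟩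
        simp only [SetLike.mem_coe, RingHom.mem_ker] at hw ⊢
        rw [Algebra.TensorProduct.lift_tmul, hw, mul_zero]
      | zero => rw [map_zero]; exact I.zero_mem
      | add x y _ _ hx hy => rw [map_add]; exact I.add_mem hx hy
      | smul a x _ hx =>
        rw [smul_eq_mul, map_mul]
        exact I.mul_mem_left _ hx
    have hker : Smash.equivTensor actQ x ∈
        LinearMap.ker (TensorProduct.map π.toLinearMap (p : H →ₗ[k] K)) := by
      rw [LinearMap.mem_ker, ← hM.equivTensor_smashProjection hC,
        show hM.smashProjection hC x = 0 from hx, map_zero]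
    rw [TensorProduct.map_ker (LinearMap.exact_subtype_ker_map π.toLinearMap)
      hM.deformation.surjective (LinearMap.exact_subtype_ker_map (p : H →ₗ[k] K)) hC.surjective,
      Submodule.mem_sup] at hker
    obtain ⟨_, ⟨y, rfl⟩, _, ⟨z, rfl⟩, hyz⟩ := hker
    rw [← (Smash.equivTensor actQ).symm_apply_apply x, ← hyz, map_add]
    clear hyz hx
    refine I.add_mem ?_ ?_
    · induction y with
      | zero => rw [map_zero, map_zero]; exact I.zero_mem
      | add y y' hy hy' => rw [map_add, map_add]; exact I.add_mem hy hy'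
      | tmul q h => exact hright q h h.2
    · induction z with
      | zero => rw [map_zero, map_zero]; exact I.zero_mem
      | add y y' hy hy' => rw [map_add, map_add]; exact I.add_mem hy hy'
      | tmul q h => exact hleft q q.2 h
  · rw [Ideal.span_le]
    rintro _ ⟨x, hx, rfl⟩
    simp only [SetLike.mem_coe, RingHom.mem_ker] at hx ⊢
    rw [smashProjection_smashInclusion, hx, map_zero]

end IsEquivariantDeformationSequence

end

theorem proposition5p8 {k W H K Z Q R : Type u} [Field k]
    [CommRing W] [HopfAlgebra k W] [Ring H] [HopfAlgebra k H] [Ring K] [HopfAlgebra k K]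
    [CommRing Z] [Algebra k Z] [Ring Q] [Algebra k Q] [Ring R] [Algebra k R]
    (j : W →ₐc[k] H) (p : H →ₐc[k] K) (hC : IsHopfDeformationSequence j p)
    (ι : Z →ₐ[k] Q) (π : Q →ₐ[k] R) (εZ : Z →ₐ[k] k) (εQ : Q →ₐ[k] k) (εR : R →ₐ[k] k)
    (actZ : ModuleAlgebra k H Z) (actQ : ModuleAlgebra k H Q) (actR : ModuleAlgebra k H R)
    (hM : IsEquivariantDeformationSequence j ι π εZ εQ εR actZ actQ actR) :
    ∃ actKR : ModuleAlgebra k K R,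
      (∀ (h : H) (q : Q), π (actQ.action h q) = actKR.action (p h) (π q)) ∧
      ∃ (ιj : Z ⊗[k] W →ₐ[k] actQ.Smash) (πp : actQ.Smash →ₐ[k] actKR.Smash)
        (εZW : Z ⊗[k] W →ₐ[k] k) (εQH : actQ.Smash →ₐ[k] k) (εRK : actKR.Smash →ₐ[k] k),
        (∀ (z : Z) (w : W), ιj (z ⊗ₜ w) = ModuleAlgebra.Smash.tmul actQ (ι z) (j w)) ∧
        (∀ (q : Q) (h : H), πp (ModuleAlgebra.Smash.tmul actQ q h) =
          ModuleAlgebra.Smash.tmul actKR (π q) (p h)) ∧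
        (∀ (z : Z) (w : W), εZW (z ⊗ₜ w) = εZ z * Coalgebra.counit (R := k) w) ∧
        (∀ (q : Q) (h : H), εQH (ModuleAlgebra.Smash.tmul actQ q h) =
          εQ q * Coalgebra.counit (R := k) h) ∧
        (∀ (r : R) (t : K), εRK (ModuleAlgebra.Smash.tmul actKR r t) =
          εR r * Coalgebra.counit (R := k) t) ∧
        IsDeformationSequence ιj πp εZW εQH εRK := by
  have hQ := hM.deformation
  have hH := hC.deformation
  have hE := hC.exact
  refine ⟨hM.quotientAction hE, hM.quotientAction_action hE, hM.smashInclusion,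
    hM.smashProjection hE, Algebra.TensorProduct.lift εZ (Bialgebra.counitAlgHom k W)
      (fun _ _ => Commute.all _ _),
    ModuleAlgebra.Smash.augmentation actQ εQ hM.augmented_Q,
    ModuleAlgebra.Smash.augmentation _ εR (hM.quotientAction_isAugmented hE),
    hM.smashInclusion_tmul, hM.smashProjection_tmul hE,
    fun z w => Algebra.TensorProduct.lift_tmul _ _ _ z w,
    fun _ _ => rfl, fun _ _ => rfl, ?_⟩
  let _ : Module Z Q := Module.compHom Q ι.toRingHom
  let _ : Module W H := Module.compHom H (j : W →ₐ[k] H).toRingHom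
  have hZtower : IsScalarTower k Z Q := ⟨fun a z q => by
    change ι (a • z) * q = a • (ι z * q)
    rw [map_smul, smul_mul_assoc]⟩
  have hWtower : IsScalarTower k W H := ⟨fun a w h => by
    change j (a • w) * h = a • (j w * h)
    rw [map_smul, smul_mul_assoc]⟩
  have hZfin : Module.Finite Z Q := hQ.finite
  have hWfin : Module.Finite W H := hH.finite
  have hZproj : Module.Projective Z Q := hQ.projective
  have hWproj : Module.Projective W H := hH.projective
  let _ : Module (Z ⊗[k] W) actQ.Smash := Module.compHom _ hM.smashInclusion.toRingHom
  -- As `W` commutes with `Q`, multiplication by `Z ⊗ W` on the smash product is componentwise, and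
  -- the tensor product criteria apply.
  have he (z : Z) (w : W) (q : Q) (h : H) :
      (ModuleAlgebra.Smash.equivTensor actQ).symm.toAddEquiv ((z • q) ⊗ₜ (w • h)) =
        (z ⊗ₜ[k] w) • (ModuleAlgebra.Smash.equivTensor actQ).symm.toAddEquiv (q ⊗ₜ h) := by
    change ModuleAlgebra.Smash.tmul actQ (ι z * q) (j w * h) =
      hM.smashInclusion (z ⊗ₜ w) * ModuleAlgebra.Smash.tmul actQ q h
    rw [hM.smashInclusion_tmul, ← ModuleAlgebra.Smash.inl_mul_inr,
      ← ModuleAlgebra.Smash.inl_mul_inr, ← ModuleAlgebra.Smash.inl_mul_inr, map_mul, map_mul,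
      mul_assoc, mul_assoc, ← mul_assoc (ModuleAlgebra.Smash.inr actQ (j w)),
      (ModuleAlgebra.Smash.commute_inr_inl j hM.trivial_W w q).eq, mul_assoc]
  have hsZ := hQ.smooth
  have hsW := hH.smooth
  have hsmooth : Algebra.Smooth k (Z ⊗[k] W) := Algebra.Smooth.tensorProduct
  have hnoeth := hH.isNoetherianRing_op
  exact
    { injective := hM.smashInclusion_injective hE.injective
      surjective := hM.smashProjection_surjective hE
      ker_eq := hM.ker_smashProjection hE
      finite := Module.Finite.of_tensor_addEquiv _ he
      flat :=
        have := Module.Projective.of_tensor_addEquiv _ he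
        Module.Flat.of_projective
      smooth := hsmooth
      finiteType := inferInstance
      central := hM.smashInclusion_central hH.central
      augmentation_ι := by
        refine AlgHom.ext fun x => ?_
        induction x with
        | zero => rw [map_zero, map_zero]
        | add x y hx hy => rw [map_add, map_add, hx, hy]
        | tmul z w =>
          rw [AlgHom.comp_apply, hM.smashInclusion_tmul, ModuleAlgebra.Smash.augmentation_tmul,
            counit_bialgHom, Algebra.TensorProduct.lift_tmul, ← hQ.augmentation_ι]
          rfl
      augmentation_π := by
        refine AlgHom.ext fun x => ?_
        induction x using ModuleAlgebra.Smash.induction_on with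
        | zero => rw [map_zero, map_zero]
        | add x y hx hy => rw [map_add, map_add, hx, hy]
        | tmul q h =>
          rw [AlgHom.comp_apply, hM.smashProjection_tmul, ModuleAlgebra.Smash.augmentation_tmul,
            ModuleAlgebra.Smash.augmentation_tmul, counit_bialgHom, ← hQ.augmentation_π]
          rfl
      finiteGlobalDimension := actQ.hasFiniteGlobalDimension_smash hQ.finiteGlobalDimension
        hH.finiteGlobalDimension }
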